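/- **Setting.** Let $x_1,\dots,x_n\in\mathbb R^p$ be i.i.d. from a sub-Gaussian law with parameter $\sigma$ (i.e. $\mathbb E\,e^{t\langle v,x_i\rangle}\le e^{\sigma^2t^2/2}$ for all unit vectors $v$ and $t\in\mathbb R$; in particular mean zero), with positive definite covariance matrix $\Sigma^*$ and $\Theta^*=(\Sigma^*)^{-1}$. Put $\widehat\Sigma=\frac1n\sum_i x_ix_i^T$, $\mathcal L_n(\Theta)=\operatorname{trace}(\widehat\Sigma\Theta)-\log\det\Theta$, $S=\operatorname{supp}(\Theta^*)=\{(j,k):\Theta^*_{jk}\ne0\}$, $s=|S|$, and let $d$ be the maximal number of nonzero entries in a row of $\Theta^*$. Write $\|\cdot\|_{\max}$, $|\!|\!|\cdot|\!|\!|_F$, $|\!|\!|\cdot|\!|\!|_2$, $|\!|\!|\cdot|\!|\!|_\infty$ for the entrywise maximum, Frobenius norm, spectral norm and maximal absolute row sum. A penalty $\rho_\lambda:\mathbb R\to\mathbb R$ is $(\mu,\gamma)$-amenable ($\mu,\gamma>0$) if (i) $\rho_\lambda$ is even and $\rho_\lambda(0)=0$; (ii) $\rho_\lambda$ is nondecreasing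 on $[0,\infty)$; (iii) $\rho_\lambda(t)/t$ is nonincreasing on $(0,\infty)$; (iv) $\rho_\lambda$ is differentiable at every $t\neq0$; (v) $\rho_\lambda(t)+\frac\mu2t^2$ is convex; (vi) $\lim_{t\to0^+}\rho_\lambda'(t)=\lambda$; (vii) $\rho_\lambda'(t)=0$ for all $t\ge\gamma\lambda$. With $\kappa=\sqrt{2/\mu}$ consider the program $$\min_{\Theta\succ0,\ |\!|\!|\Theta|\!|\!|_2\le\kappa}\Big\{\mathcal L_n(\Theta)+\sum_{j\ne k}\rho_\lambda(\Theta_{jk})\Big\}.\qquad(\ast)$$ A feasible $\widetilde\Theta$ is a stationary point of $(\ast)$ if for every feasible $\Theta$, with $D=\Theta-\widetilde\Theta$, $\langle\nabla\mathcal L_n(\widetilde\Theta),D\rangle+\lim_{t\to0^+}\sum_{j\ne k}\rho_\lambda'(\widetilde\Theta_{jk}+tD_{jk})D_{jk}\ge0$. The oracle estimator is $\widehat\Theta^{\mathcal O}=\arg\min\{\mathcal L_n(\Theta):\Theta\succ0,\ \operatorname{supp}(\Theta)\subseteq S\}$. **Statement.** Let $\sigma,c_\infty,K,\mu>0$ and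 $0<\kappa_0<\kappa=\sqrt{2/\mu}$. There are constants $c_\ell,c_0,c_1,c_2,c_3>0$, depending only on $(\sigma,c_\infty,K,\mu,\kappa_0)$, and for every $c_u\ge c_\ell$ a constant $c_\beta\ge c_3$ (depending on these and on $c_u$), such that the following holds for all $n$, $p$, $\gamma>0$, $\lambda$, all $(\mu,\gamma)$-amenable $\rho_\lambda$, and all data as above. Suppose $|\!|\!|\Sigma^*|\!|\!|_\infty\le K$, $|\!|\!|\Theta^*|\!|\!|_2\le\kappa_0$, $$|\!|\!|\big(((\Theta^*\otimes\Theta^*)^{-1})_{SS}\big)^{-1}|\!|\!|_\infty\le c_\infty,\qquad n\ge c_0d^2\log p,\qquad c_\ell\sqrt{\tfrac{\log p}n}\le\lambda\le c_u\sqrt{\tfrac{\log p}n},$$ $$\min_{(j,k)\in S}|\Theta^*_{jk}|\ \ge\ \lambda(\gamma+2c_\infty)+c_\beta\sqrt{\tfrac{\log p}n}.$$ Then with probability at least $1-c_1\exp(-c_2\log p)$ the program $(\ast)$ has a unique stationary point $\widehat\Theta$; it is the unique minimizer of $(\ast)$, it equals the oracle estimator $\widehat\Theta^{\mathcal O}$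 (which exists and is unique), and $$\|\widehat\Theta-\Theta^*\|_{\max}\le c_3\sqrt{\tfrac{\log p}n},\qquad |\!|\!|\widehat\Theta-\Theta^*|\!|\!|_F\le c_3\sqrt{\tfrac{s\log p}n},\qquad |\!|\!|\widehat\Theta-\Theta^*|\!|\!|_2\le c_3\min\{\sqrt s,d\}\sqrt{\tfrac{\log p}n}.$$ -/

import Mathlib

open MeasureTheory ProbabilityTheory Filter Topology Matrix
open scoped NNReal Kronecker

noncomputable section

namespace GLasso

/-! ### Matrix norms -/

/-- The maximum absolute row sum, i.e. the operator norm induced by the sup norm. -/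
def rowSumNorm {m n : Type*} [Fintype n] (A : Matrix m n ℝ) : ℝ :=
  ⨆ i, ∑ j, |A i j|

/-- The spectral norm: the operator norm induced by the Euclidean norm. -/
def specNorm {p : ℕ} (A : Matrix (Fin p) (Fin p) ℝ) : ℝ :=
  ‖Matrix.toEuclideanCLM (n := Fin p) (𝕜 := ℝ) A‖

/-- The Frobenius norm. -/
def frobNorm {p : ℕ} (A : Matrix (Fin p) (Fin p) ℝ) : ℝ :=
  Real.sqrt (∑ j, ∑ k, (A j k) ^ 2)

/-! ### Amenable regularizers -/

/-- `ρ` is `μ`-amenable with regularization parameter `lam`. -/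
structure IsAmenable (μ lam : ℝ) (ρ : ℝ → ℝ) : Prop where
  symm : ∀ t, ρ t = ρ (-t)
  zero : ρ 0 = 0
  mono : MonotoneOn ρ (Set.Ici 0)
  ratio_anti : AntitoneOn (fun t => ρ t / t) (Set.Ioi 0)
  diff : ∀ t, t ≠ 0 → DifferentiableAt ℝ ρ t
  convex : ConvexOn ℝ Set.univ (fun t => ρ t + μ / 2 * t ^ 2)
  selection : Tendsto (deriv ρ) (𝓝[>] 0) (𝓝 lam)

/-- `ρ` is `(μ, γ)`-amenable with regularization parameter `lam`. -/
structure IsAmenableWith (μ γ lam : ℝ) (ρ : ℝ → ℝ) : Prop extends IsAmenable μ lam ρ where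
  unbiased : ∀ t, γ * lam ≤ t → deriv ρ t = 0

/-! ### Sparsity -/

/-- The support of a matrix (all ordered pairs, diagonal included). -/
def supp {p : ℕ} (Θ : Matrix (Fin p) (Fin p) ℝ) : Finset (Fin p × Fin p) :=
  {q | Θ q.1 q.2 ≠ 0}

/-- The total number of nonzero entries. -/
def numNonzero {p : ℕ} (Θ : Matrix (Fin p) (Fin p) ℝ) : ℕ :=
  (supp Θ).card

/-- The maximal number of nonzero entries in a row. -/
def maxRowNonzero {p : ℕ} (Θ : Matrix (Fin p) (Fin p) ℝ) : ℕ :=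
  Finset.univ.sup fun j : Fin p => (Finset.univ.filter fun k : Fin p => Θ j k ≠ 0).card

/-- The inverse of the `S × S` block of the population Hessian `(Θ ⊗ Θ)⁻¹ = Θ⁻¹ ⊗ Θ⁻¹` of the
graphical Lasso loss at `Θ`, where `S` is the support of `Θ`. -/
def invHessianSupp {p : ℕ} (Θ : Matrix (Fin p) (Fin p) ℝ) : Matrix (supp Θ) (supp Θ) ℝ :=
  (((Θ ⊗ₖ Θ)⁻¹).submatrix (Subtype.val : supp Θ → Fin p × Fin p) Subtype.val)⁻¹

/-! ### The data -/

/-- The covariance matrix of a law on `ℝ^p`. -/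
def covMat {p : ℕ} (ν : Measure (Fin p → ℝ)) : Matrix (Fin p) (Fin p) ℝ :=
  Matrix.of fun j k => covariance (fun x => x j) (fun x => x k) ν

/-- A (mean-zero) sub-Gaussian law on `ℝ^p` with parameter `σ`: every one-dimensional projection
`⟨v, x⟩` along a unit vector satisfies `E exp (t ⟨v, x⟩) ≤ exp (σ² t² / 2)` for all `t`. -/
def IsSubGaussianLaw {p : ℕ} (σ : ℝ≥0) (ν : Measure (Fin p → ℝ)) : Prop :=
  ∀ v : Fin p → ℝ, v ⬝ᵥ v = 1 → HasSubgaussianMGF (fun x => v ⬝ᵥ x) (σ ^ 2) ν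

/-- The sample covariance matrix `(1 / n) ∑ᵢ xᵢ xᵢᵀ`. -/
def sampleCov {n p : ℕ} (x : Fin n → Fin p → ℝ) : Matrix (Fin p) (Fin p) ℝ :=
  (1 / (n : ℝ)) • ∑ i, Matrix.vecMulVec (x i) (x i)

/-! ### The optimization program -/

/-- The graphical Lasso loss (only used at positive definite `Θ`). -/
def loss {p : ℕ} (Shat Θ : Matrix (Fin p) (Fin p) ℝ) : ℝ :=
  (Shat * Θ).trace - Real.log Θ.det

/-- The penalty: sum of `ρ` over the off-diagonal entries. -/
def penalty {p : ℕ} (ρ : ℝ → ℝ) (Θ : Matrix (Fin p) (Fin p) ℝ) : ℝ :=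
  ∑ j, ∑ k, if j = k then 0 else ρ (Θ j k)

/-- The objective function of the program. -/
def objective {p : ℕ} (Shat : Matrix (Fin p) (Fin p) ℝ) (ρ : ℝ → ℝ)
    (Θ : Matrix (Fin p) (Fin p) ℝ) : ℝ :=
  loss Shat Θ + penalty ρ Θ

/-- The feasible set: symmetric positive definite matrices with spectral norm at most `κ`. -/
def feasible (p : ℕ) (κ : ℝ) : Set (Matrix (Fin p) (Fin p) ℝ) :=
  {Θ | Θ.PosDef ∧ specNorm Θ ≤ κ}

/-- `Θ` is a solution of the program. -/
def IsProgramMinimizer {p : ℕ} (Shat : Matrix (Fin p) (Fin p) ℝ) (ρ : ℝ → ℝ) (κ : ℝ)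
    (Θ : Matrix (Fin p) (Fin p) ℝ) : Prop :=
  Θ ∈ feasible p κ ∧ ∀ Θ' ∈ feasible p κ, objective Shat ρ Θ ≤ objective Shat ρ Θ'

/-- `Θ` is a stationary point of the program: `Θ` is feasible, and for every feasible `Θ'`, with
`D = Θ' - Θ`, the sum of `g = ⟨∇ loss Θ, D⟩` and of
`l = lim_{t → 0+} ⟨∇ penalty (Θ + t D), D⟩` is nonnegative. -/
def IsStationary {p : ℕ} (Shat : Matrix (Fin p) (Fin p) ℝ) (ρ : ℝ → ℝ) (κ : ℝ)
    (Θ : Matrix (Fin p) (Fin p) ℝ) : Prop :=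
  Θ ∈ feasible p κ ∧ ∀ Θ' ∈ feasible p κ, ∃ g l : ℝ,
    HasDerivAt (fun t : ℝ => loss Shat (Θ + t • (Θ' - Θ))) g 0 ∧
    Tendsto (fun t : ℝ => ∑ j, ∑ k, if j = k then 0 else
      deriv ρ ((Θ + t • (Θ' - Θ)) j k) * (Θ' - Θ) j k) (𝓝[>] 0) (𝓝 l) ∧
    0 ≤ g + l

/-- `Θ` is an oracle estimator: it minimizes the unpenalized loss over the positive definite
matrices with support in `S` (at singular positive semidefinite matrices the loss is `+∞`). -/
def IsOracle {p : ℕ} (Shat : Matrix (Fin p) (Fin p) ℝ) (S : Finset (Fin p × Fin p))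
    (Θ : Matrix (Fin p) (Fin p) ℝ) : Prop :=
  (Θ.PosDef ∧ supp Θ ⊆ S) ∧
    ∀ Θ' : Matrix (Fin p) (Fin p) ℝ, Θ'.PosDef → supp Θ' ⊆ S → loss Shat Θ ≤ loss Shat Θ'

end GLasso

end

namespace GLasso

/-! ### Amenable regularizers -/

namespace IsAmenable

variable {μ lam : ℝ} {ρ : ℝ → ℝ}

/-! The argument separates a deterministic certificate from one probabilistic input, the entrywise
bound `|Shat - Σ*| ≤ w` with `w` of order `√(log p / n)`.

Certificate (`IsCertified`). Suppose a positive definite `T` supported on `S` has spectral norm at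
most `a < κ`, solves the score equation `(Shat - T⁻¹)_S = 0`, has gradient at most `lam / 2` off
`S`, and has entries on `S` beyond the flat threshold `γ lam` by a margin `4 lam / μ`. Any other
feasible `Θ` is compared with `T` alone. The loss has curvature at least `1 / (a κ)` between them,
strictly more than `1 / κ² = μ / 2`. The penalty could have curvature as low as `-μ`, so the
objective need not be convex. Along the segment to `T`, however, the margin on `S` and the gradient
slack off `S` cut the deficit to `μ / 2`. Hence `T` is the only stationary point
(`IsCertified.eq_of_isStationary`), and the same comparison of values makes it the only minimizer
(`IsCertified.objective_ge`). On matrices supported in `S` the gradient term vanishes, so `T` is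
also the oracle.

Existence (`exists_isCertified`). Write `T = Θ* + D`. The score equation is a fixed-point equation
for a Newton map with the Hessian block on `S` frozen at `Θ*`. In the sup-norm ball of radius `r = 2
c∞ w` this map is a contraction, because the linearization error of matrix inversion carries a
factor `d r`, which is small when `n ≥ c₀ d² log p` (`exists_score_solution`). The bound `|D j k| ≤
r` then gives all three error rates, and the lower bounds on `lam` and on the signal give the
gradient and size conditions.

Probability (`exists_sampleCov_event`). Products of sub-Gaussian coordinates are sub-exponential, so
a Chernoff bound and a union over the `p²` entries control `Shat - Σ*`. -/

theorem continuous (h : IsAmenable μ lam ρ) : Continuous ρ := by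
  have h1 : ContinuousOn (fun t => ρ t + μ / 2 * t ^ 2) Set.univ :=
    h.convex.continuousOn isOpen_univ
  have h2 := (continuousOn_univ.1 h1).sub (by fun_prop : Continuous fun t : ℝ => μ / 2 * t ^ 2)
  exact h2.congr fun t => by simp

theorem deriv_neg (h : IsAmenable μ lam ρ) (t : ℝ) : deriv ρ (-t) = -deriv ρ t := by
  have h1 : (fun x => ρ (-x)) = ρ := funext fun x => (h.symm x).symm
  have h2 := deriv_comp_neg ρ t
  rw [h1] at h2
  linarith

theorem deriv_zero (h : IsAmenable μ lam ρ) : deriv ρ 0 = 0 := by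
  have := h.deriv_neg 0
  rw [neg_zero] at this
  linarith

theorem apply_abs (h : IsAmenable μ lam ρ) (t : ℝ) : ρ |t| = ρ t := by
  rcases abs_cases t with ⟨h1, _⟩ | ⟨h1, _⟩ <;> rw [h1]
  exact (h.symm t).symm

theorem deriv_mul_eq_abs (h : IsAmenable μ lam ρ) (t : ℝ) :
    deriv ρ t * t = deriv ρ |t| * |t| := by
  rcases abs_cases t with ⟨h1, _⟩ | ⟨h1, _⟩ <;> rw [h1]
  rw [h.deriv_neg]; ring

theorem abs_deriv (h : IsAmenable μ lam ρ) (t : ℝ) : |deriv ρ t| = |deriv ρ (|t|)| := by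
  rcases abs_cases t with ⟨h1, _⟩ | ⟨h1, _⟩ <;> rw [h1]
  rw [h.deriv_neg, abs_neg]

theorem deriv_nonneg (h : IsAmenable μ lam ρ) {t : ℝ} (ht : 0 < t) : 0 ≤ deriv ρ t := by
  have h1 : derivWithin ρ (Set.Ici 0) t = deriv ρ t :=
    derivWithin_of_mem_nhds (Ici_mem_nhds ht)
  rw [← h1]
  exact h.mono.derivWithin_nonneg

/-- Convexity makes `ρ' + μ t` nondecreasing on the positive axis, and its limit at `0+` is `lam`.
-/
theorem le_deriv_add (h : IsAmenable μ lam ρ) {t : ℝ} (ht : 0 < t) :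
    lam ≤ deriv ρ t + μ * t := by
  set g : ℝ → ℝ := fun t => ρ t + μ / 2 * t ^ 2
  have hd : ∀ x ∈ Set.Ioi (0 : ℝ), HasDerivAt g (deriv ρ x + μ * x) x := by
    intro x hx
    have := (h.diff x (ne_of_gt hx)).hasDerivAt.add ((hasDerivAt_pow 2 x).const_mul (μ / 2))
    exact this.congr_deriv (by norm_num; ring)
  have hm : MonotoneOn (deriv g) (Set.Ioi 0) :=
    (h.convex.subset (Set.subset_univ _) (convex_Ioi 0)).monotoneOn_deriv
      fun x hx => (hd x hx).differentiableAt
  have hl : Tendsto (fun x => deriv ρ x + μ * x) (𝓝[>] 0) (𝓝 (lam + μ * 0)) :=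
    h.selection.add (((continuous_const.mul continuous_id).tendsto 0).mono_left nhdsWithin_le_nhds)
  rw [mul_zero, add_zero] at hl
  refine le_of_tendsto hl ?_
  filter_upwards [Ioo_mem_nhdsGT ht] with x hx
  have := hm hx.1 ht hx.2.le
  rwa [(hd x hx.1).deriv, (hd t ht).deriv] at this

/-- The ratio `ρ t / t` only grows as `t` decreases, and near `0` the mean value theorem identifies
it with a value of `ρ'`, which is close to `lam`. -/
theorem apply_le (h : IsAmenable μ lam ρ) {t : ℝ} (ht : 0 < t) : ρ t ≤ lam * t := by
  rw [← div_le_iff₀ ht]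
  refine le_of_forall_pos_le_add fun ε hε => ?_
  have h1 : ∀ᶠ x in 𝓝[>] (0 : ℝ), deriv ρ x < lam + ε :=
    h.selection.eventually_lt_const (by linarith)
  obtain ⟨δ, hδ, hδ'⟩ := mem_nhdsGT_iff_exists_Ioo_subset.1 h1
  have hδ0 : (0 : ℝ) < δ := hδ
  set s := min (δ / 2) t
  have hs : 0 < s := lt_min (by linarith) ht
  obtain ⟨ξ, hξ, hξ'⟩ := exists_deriv_eq_slope ρ hs h.continuous.continuousOn
    fun x hx => (h.diff x (ne_of_gt hx.1)).differentiableWithinAt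
  have h2 : deriv ρ ξ < lam + ε :=
    hδ' ⟨hξ.1, hξ.2.trans_le ((min_le_left _ _).trans (by linarith))⟩
  have h3 : ρ t / t ≤ ρ s / s := h.ratio_anti hs ht (min_le_right _ _)
  rw [hξ', h.zero, sub_zero, sub_zero] at h2
  linarith

/-- Since `ρ t / t` is nonincreasing, its derivative gives `t ρ' t ≤ ρ t`. -/
theorem deriv_le (h : IsAmenable μ lam ρ) {t : ℝ} (ht : 0 < t) : deriv ρ t ≤ lam := by
  have hd : HasDerivAt (fun x => ρ x / x) ((deriv ρ t * t - ρ t * 1) / t ^ 2) t :=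
    (h.diff t ht.ne').hasDerivAt.div (hasDerivAt_id t) ht.ne'
  have h1 : derivWithin (fun x => ρ x / x) (Set.Ioi 0) t = (deriv ρ t * t - ρ t * 1) / t ^ 2 := by
    rw [derivWithin_of_mem_nhds (Ioi_mem_nhds ht), hd.deriv]
  have h2 := h.ratio_anti.derivWithin_nonpos (x := t)
  rw [h1, div_le_iff₀ (by positivity)] at h2
  have h3 := h.apply_le ht
  have h4 : deriv ρ t * t ≤ lam * t := by linarith
  exact le_of_mul_le_mul_right h4 ht

theorem lam_nonneg (h : IsAmenable μ lam ρ) : 0 ≤ lam :=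
  (h.deriv_nonneg one_pos).trans (h.deriv_le one_pos)

theorem abs_deriv_le (h : IsAmenable μ lam ρ) (t : ℝ) : |deriv ρ t| ≤ lam := by
  rw [h.abs_deriv]
  rcases (abs_nonneg t).eq_or_lt with h0 | h0
  · rw [← h0, h.deriv_zero, abs_zero]; exact h.lam_nonneg
  · rw [abs_of_nonneg (h.deriv_nonneg h0)]; exact h.deriv_le h0

theorem le_apply (h : IsAmenable μ lam ρ) {t : ℝ} (ht : 0 ≤ t) :
    lam * t - μ / 2 * t ^ 2 ≤ ρ t := by
  have hm : MonotoneOn (fun x => ρ x - (lam * x - μ / 2 * x ^ 2)) (Set.Ici 0) := by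
    refine monotoneOn_of_deriv_nonneg (convex_Ici 0) ?_ ?_ ?_
    · exact (h.continuous.sub (by fun_prop)).continuousOn
    · intro x hx
      rw [interior_Ici] at hx
      exact ((h.diff x (ne_of_gt hx)).sub (by fun_prop)).differentiableWithinAt
    · intro x hx
      rw [interior_Ici] at hx
      have h1 : HasDerivAt (fun x => ρ x - (lam * x - μ / 2 * x ^ 2))
          (deriv ρ x - (lam * 1 - μ / 2 * ((2 : ℕ) * x ^ (2 - 1)))) x :=
        (h.diff x (ne_of_gt hx)).hasDerivAt.sub
          (((hasDerivAt_id x).const_mul lam).sub ((hasDerivAt_pow 2 x).const_mul (μ / 2)))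
      rw [h1.deriv]
      have := h.le_deriv_add hx
      norm_num
      linarith
  have := hm Set.self_mem_Ici ht ht
  simp only [h.zero] at this
  linarith

theorem sub_le (h : IsAmenable μ lam ρ) {s t : ℝ} (hs : 0 ≤ s) (hst : s ≤ t) :
    ρ t - ρ s ≤ lam * (t - s) := by
  refine Convex.image_sub_le_mul_sub_of_deriv_le (convex_Ici (0 : ℝ)) h.continuous.continuousOn
    ?_ ?_ s hs t (hs.trans hst) hst
  · intro x hx
    rw [interior_Ici] at hx
    exact (h.diff x (ne_of_gt hx)).differentiableWithinAt
  · intro x hx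
    rw [interior_Ici] at hx
    exact h.deriv_le hx

/-- Off the support: the one-sided derivative of the penalty towards `0` dominates a dual
certificate of size `lam / 2`, up to the curvature `μ / 2`. -/
theorem zero_direction_le (h : IsAmenable μ lam ρ) (hμ : 0 < μ) {w θ t : ℝ} (hw : |w| ≤ lam / 2)
    (ht : 0 < t) (ht' : t < 1) :
    -(w * θ) + deriv ρ (θ + t * (0 - θ)) * (0 - θ) ≤ μ / 2 * θ ^ 2 := by
  rcases eq_or_ne θ 0 with rfl | hθ
  · simp
  have hθ' : 0 < |θ| := abs_pos.2 hθ
  have h1 : θ + t * (0 - θ) = (1 - t) * θ := by ring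
  have h2 : |(1 - t) * θ| = (1 - t) * |θ| := by
    rw [abs_mul, abs_of_pos (by linarith : 0 < 1 - t)]
  have hx : 0 < (1 - t) * |θ| := mul_pos (by linarith) hθ'
  have h3 : deriv ρ ((1 - t) * θ) * θ = deriv ρ ((1 - t) * |θ|) * |θ| := by
    have := h.deriv_mul_eq_abs ((1 - t) * θ)
    rw [h2] at this
    have ht1 : (1 - t) ≠ 0 := by linarith
    apply mul_left_cancel₀ ht1
    linarith
  have h4 := h.deriv_nonneg hx
  have h5 := h.le_deriv_add hx
  have h6 : -(w * θ) ≤ lam / 2 * |θ| := by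
    have := neg_abs_le (w * θ)
    rw [abs_mul] at this
    nlinarith
  rw [h1, ← sq_abs θ]
  set x := |θ|
  set e := deriv ρ ((1 - t) * x)
  have h7 : deriv ρ ((1 - t) * θ) * (0 - θ) = -(e * x) := by rw [← h3]; ring
  rw [h7]
  have h8 : lam ≤ e + μ * x := by nlinarith [mul_pos hμ hθ', mul_pos (mul_pos hμ hθ') ht]
  -- With `e ≥ max 0 (lam - μ x)` the left side is at most `lam x / 2 - e x`. For large `x` the
  -- bound `e ≥ 0` suffices, for small `x` the other one does; they meet at `x = lam / μ`.
  rcases le_total lam (μ * x) with h9 | h9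
  · nlinarith [mul_nonneg h4 hθ'.le]
  · nlinarith [mul_nonneg h4 hθ'.le]

/-- Counterpart of `zero_direction_le` for values: `ρ` lies above both `0` and `lam |θ| - μ θ² / 2`,
and the better of the two is played against `lam |θ| / 2`. -/
theorem zero_value_le (h : IsAmenable μ lam ρ) {w θ : ℝ} (hw : |w| ≤ lam / 2) :
    -(μ / 4 * θ ^ 2) ≤ w * θ + ρ θ := by
  have h1 := h.le_apply (abs_nonneg θ)
  have h2 : 0 ≤ ρ |θ| := by
    rw [← h.zero]; exact h.mono Set.self_mem_Ici (abs_nonneg θ) (abs_nonneg θ)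
  have h6 : -(lam / 2 * |θ|) ≤ w * θ := by
    have := neg_abs_le (w * θ)
    rw [abs_mul] at this
    nlinarith [abs_nonneg θ]
  rw [h.apply_abs] at h1 h2
  rw [← sq_abs θ]
  rcases le_total (lam / 2 * |θ|) (μ / 4 * |θ| ^ 2) with h9 | h9 <;> linarith

theorem tendsto_deriv_zero (h : IsAmenable μ lam ρ) (D : ℝ) :
    Tendsto (fun t : ℝ => deriv ρ (0 + t * D) * D) (𝓝[>] 0) (𝓝 (lam * |D|)) := by
  rcases eq_or_ne D 0 with rfl | hD
  · simp
  have hD' : 0 < |D| := abs_pos.2 hD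
  have h1 : Tendsto (fun t : ℝ => t * |D|) (𝓝[>] 0) (𝓝[>] 0) := by
    refine tendsto_nhdsWithin_iff.2 ⟨?_, ?_⟩
    · have : Tendsto (fun t : ℝ => t * |D|) (𝓝 0) (𝓝 (0 * |D|)) :=
        (continuous_id.mul continuous_const).tendsto 0
      rw [zero_mul] at this
      exact this.mono_left nhdsWithin_le_nhds
    · filter_upwards [self_mem_nhdsWithin] with t ht
      exact mul_pos ht hD'
  refine ((h.selection.comp h1).mul_const |D|).congr' ?_
  filter_upwards with t
  simp only [Function.comp, zero_add]
  rcases abs_cases D with ⟨h2, _⟩ | ⟨h2, _⟩ <;> rw [h2]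
  rw [show t * -D = -(t * D) by ring, h.deriv_neg]; ring

end IsAmenable

/-! ### Penalties that are flat beyond `γ * lam` -/

namespace IsAmenableWith

variable {μ γ lam : ℝ} {ρ : ℝ → ℝ}

theorem deriv_eq_zero (h : IsAmenableWith μ γ lam ρ) {t : ℝ} (ht : γ * lam ≤ |t|) :
    deriv ρ t = 0 := by
  rw [← abs_eq_zero, h.abs_deriv, h.unbiased _ ht, abs_zero]

theorem tendsto_deriv_of_lt (h : IsAmenableWith μ γ lam ρ) {a : ℝ} (ha : γ * lam < |a|) (D : ℝ) :
    Tendsto (fun t : ℝ => deriv ρ (a + t * D) * D) (𝓝[>] 0) (𝓝 0) := by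
  have h1 : Tendsto (fun t : ℝ => |a + t * D|) (𝓝[>] 0) (𝓝 |a + 0 * D|) :=
    ((by fun_prop : Continuous fun t : ℝ => |a + t * D|).tendsto 0).mono_left nhdsWithin_le_nhds
  rw [zero_mul, add_zero] at h1
  refine tendsto_const_nhds.congr' ?_
  filter_upwards [h1.eventually_const_lt ha] with t ht
  rw [h.deriv_eq_zero ht.le, zero_mul]

/-- The penalty has a slope only inside the threshold `γ lam`. A segment issuing from `a` that gets
there has length at least `4 lam / μ`, so the slope, at most `lam`, is at most `μ / 4` times that
length. -/
theorem support_direction_le (h : IsAmenableWith μ γ lam ρ) (hμ : 0 < μ) {a θ t : ℝ}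
    (ha : γ * lam + 4 / μ * lam ≤ |a|) (ht : 0 < t) (ht' : t < 1) :
    deriv ρ (θ + t * (a - θ)) * (a - θ) ≤ μ / 4 * (a - θ) ^ 2 := by
  rcases le_or_gt (γ * lam) |θ + t * (a - θ)| with h1 | h1
  · rw [h.deriv_eq_zero h1, zero_mul]; positivity
  have h2 : 4 / μ * lam ≤ |a - θ| := by
    have h3 : |a| - |θ + t * (a - θ)| ≤ |a - (θ + t * (a - θ))| := abs_sub_abs_le_abs_sub _ _
    have h4 : a - (θ + t * (a - θ)) = (1 - t) * (a - θ) := by ring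
    rw [h4, abs_mul, abs_of_pos (by linarith : 0 < 1 - t)] at h3
    nlinarith [abs_nonneg (a - θ)]
  have h5 : lam ≤ μ / 4 * |a - θ| := by
    have := mul_le_mul_of_nonneg_left h2 (by positivity : 0 ≤ μ / 4)
    rwa [← mul_assoc, show μ / 4 * (4 / μ) = 1 by field_simp, one_mul] at this
  calc deriv ρ (θ + t * (a - θ)) * (a - θ) ≤ |deriv ρ (θ + t * (a - θ))| * |a - θ| := by
        rw [← abs_mul]; exact le_abs_self _
    _ ≤ μ / 4 * |a - θ| * |a - θ| :=
        mul_le_mul_of_nonneg_right ((h.abs_deriv_le _).trans h5) (abs_nonneg _)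
    _ = μ / 4 * (a - θ) ^ 2 := by rw [← sq_abs (a - θ)]; ring

theorem apply_eq (h : IsAmenableWith μ γ lam ρ) (hγ : 0 < γ) (hlam : 0 < lam) {s t : ℝ}
    (hs : γ * lam ≤ s) (ht : s ≤ t) : ρ t = ρ s := by
  have h0 : 0 < γ * lam := mul_pos hγ hlam
  refine le_antisymm ?_ (h.mono (h0.le.trans hs) (h0.le.trans (hs.trans ht)) ht)
  have := Convex.image_sub_le_mul_sub_of_deriv_le (C := 0) (convex_Icc s t)
    h.continuous.continuousOn
    (fun x hx => (h.diff x ?_).differentiableWithinAt)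
    (fun x hx => (h.unbiased x ?_).le) s (Set.left_mem_Icc.2 ht) t (Set.right_mem_Icc.2 ht) ht
  · linarith
  · have := (interior_subset hx).1
    exact (h0.trans_le (hs.trans this)).ne'
  · exact hs.trans (interior_subset hx).1

/-- Value form of `support_direction_le`: the penalty can only drop if `|θ|` is below the threshold,
at distance at least `4 lam / μ` from `|a|`. -/
theorem support_value_le (h : IsAmenableWith μ γ lam ρ) (hμ : 0 < μ) (hγ : 0 < γ) (hlam : 0 < lam)
    {a θ : ℝ} (ha : γ * lam + 4 / μ * lam ≤ |a|) :
    ρ a - ρ θ ≤ μ / 4 * (a - θ) ^ 2 := by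
  rw [← h.apply_abs a, ← h.apply_abs θ]
  have hγl : 0 < γ * lam := mul_pos hγ hlam
  have hla : 0 < 4 / μ * lam := by positivity
  rcases le_or_gt (γ * lam) |θ| with h1 | h1
  · have : ρ |a| ≤ ρ |θ| := by
      rcases le_total |a| |θ| with h2 | h2
      · exact h.mono (abs_nonneg a) (abs_nonneg θ) h2
      · exact (h.apply_eq hγ hlam h1 h2).le
    have : 0 ≤ μ / 4 * (a - θ) ^ 2 := by positivity
    linarith
  have h3 : |a| - |θ| ≤ |a - θ| := abs_sub_abs_le_abs_sub _ _
  have h4 := h.sub_le (abs_nonneg θ) (by linarith : |θ| ≤ |a|)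
  have h2 : 4 / μ * lam ≤ |a - θ| := by linarith
  have h5 : lam ≤ μ / 4 * |a - θ| := by
    have := mul_le_mul_of_nonneg_left h2 (by positivity : 0 ≤ μ / 4)
    rwa [← mul_assoc, show μ / 4 * (4 / μ) = 1 by field_simp, one_mul] at this
  rw [← sq_abs (a - θ)]
  nlinarith [mul_le_mul h5 h3 (by linarith) (by positivity)]

end IsAmenableWith

/-! ### Quadratic forms and matrix norms -/

theorem norm_toLp_sq {p : ℕ} (x : Fin p → ℝ) : ‖WithLp.toLp 2 x‖ ^ 2 = x ⬝ᵥ x := by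
  rw [EuclideanSpace.real_norm_sq_eq]
  simp [dotProduct, sq]

theorem dotProduct_self_nonneg_real {p : ℕ} (x : Fin p → ℝ) : 0 ≤ x ⬝ᵥ x := by
  rw [← norm_toLp_sq]; positivity

theorem specNorm_add_le {p : ℕ} (A B : Matrix (Fin p) (Fin p) ℝ) :
    specNorm (A + B) ≤ specNorm A + specNorm B := by
  unfold specNorm
  rw [map_add]
  exact norm_add_le _ _

theorem specNorm_smul {p : ℕ} (c : ℝ) (A : Matrix (Fin p) (Fin p) ℝ) :
    specNorm (c • A) = |c| * specNorm A := by
  unfold specNorm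
  rw [map_smul, norm_smul, Real.norm_eq_abs]

theorem abs_dotProduct_mulVec_le {p : ℕ} (A : Matrix (Fin p) (Fin p) ℝ) (x : Fin p → ℝ) :
    |x ⬝ᵥ A *ᵥ x| ≤ specNorm A * (x ⬝ᵥ x) := by
  have h1 := Matrix.inner_toEuclideanCLM A (WithLp.toLp 2 x) (WithLp.toLp 2 x)
  rw [← norm_toLp_sq, ← h1]
  refine (abs_real_inner_le_norm _ _).trans ?_
  have := (Matrix.toEuclideanCLM (n := Fin p) (𝕜 := ℝ) A).le_opNorm (WithLp.toLp 2 x)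
  unfold specNorm
  nlinarith [norm_nonneg (WithLp.toLp 2 x)]

theorem specNorm_le_of_sq_le {p : ℕ} {A : Matrix (Fin p) (Fin p) ℝ} {c : ℝ} (hc : 0 ≤ c)
    (h : ∀ x : Fin p → ℝ, (A *ᵥ x) ⬝ᵥ (A *ᵥ x) ≤ c ^ 2 * (x ⬝ᵥ x)) : specNorm A ≤ c := by
  refine ContinuousLinearMap.opNorm_le_bound _ hc fun x => ?_
  have h1 := h (WithLp.ofLp x)
  rw [← norm_toLp_sq, ← norm_toLp_sq, ← mul_pow] at h1
  exact abs_le_of_sq_le_sq' h1 (by positivity) |>.2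

theorem sum_abs_le_rowSumNorm {m n : Type*} [Fintype m] [Fintype n] (A : Matrix m n ℝ) (i : m) :
    ∑ j, |A i j| ≤ rowSumNorm A :=
  le_ciSup (f := fun i => ∑ j, |A i j|) (Set.finite_range _).bddAbove i

/-- Schur test: Cauchy–Schwarz in each row with weights `|A i j|`, then summation over columns. -/
theorem specNorm_le_of_sum_abs_le {p : ℕ} {A : Matrix (Fin p) (Fin p) ℝ} {c : ℝ} (hc : 0 ≤ c)
    (hr : ∀ i, ∑ j, |A i j| ≤ c) (hcol : ∀ j, ∑ i, |A i j| ≤ c) : specNorm A ≤ c := by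
  refine specNorm_le_of_sq_le hc fun x => ?_
  have h1 : ∀ i, (A *ᵥ x) i * (A *ᵥ x) i ≤ c * ∑ j, |A i j| * x j ^ 2 := by
    intro i
    rw [← sq]
    refine (Finset.sum_sq_le_sum_mul_sum_of_sq_le_mul Finset.univ (f := fun j => |A i j|)
      (g := fun j => |A i j| * x j ^ 2) (fun _ _ => abs_nonneg _)
      (fun _ _ => mul_nonneg (abs_nonneg _) (sq_nonneg _)) fun j _ => ?_).trans ?_
    · rw [mul_pow, ← sq_abs (A i j)]; exact le_of_eq (by ring)
    · exact mul_le_mul_of_nonneg_right (hr i)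
        (Finset.sum_nonneg fun j _ => mul_nonneg (abs_nonneg _) (sq_nonneg _))
  calc (A *ᵥ x) ⬝ᵥ (A *ᵥ x) ≤ ∑ i, c * ∑ j, |A i j| * x j ^ 2 := Finset.sum_le_sum fun i _ => h1 i
    _ = c * ∑ j, (∑ i, |A i j|) * x j ^ 2 := by
        rw [← Finset.mul_sum, Finset.sum_comm]
        simp_rw [Finset.sum_mul]
    _ ≤ c * ∑ j, c * x j ^ 2 := by
        refine mul_le_mul_of_nonneg_left (Finset.sum_le_sum fun j _ => ?_) hc
        exact mul_le_mul_of_nonneg_right (hcol j) (sq_nonneg _)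
    _ = c ^ 2 * (x ⬝ᵥ x) := by
        rw [← Finset.mul_sum, ← mul_assoc, ← sq]
        simp [dotProduct, sq]

theorem specNorm_le_frobNorm {p : ℕ} (A : Matrix (Fin p) (Fin p) ℝ) : specNorm A ≤ frobNorm A := by
  refine specNorm_le_of_sq_le (Real.sqrt_nonneg _) fun x => ?_
  unfold frobNorm
  rw [Real.sq_sqrt (by positivity), Finset.sum_mul]
  refine Finset.sum_le_sum fun i _ => ?_
  rw [← sq]
  have := Finset.sum_mul_sq_le_sq_mul_sq Finset.univ (A i) x
  simpa [dotProduct, mulVec, sq] using this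

open scoped MatrixOrder Matrix.Norms.L2Operator in
theorem PosSemidef.trace_mul_nonneg {p : ℕ} {A B : Matrix (Fin p) (Fin p) ℝ} (hA : A.PosSemidef)
    (hB : B.PosSemidef) : 0 ≤ (A * B).trace := by
  obtain ⟨M, rfl⟩ := CStarAlgebra.nonneg_iff_eq_star_mul_self.mp hB.nonneg
  rw [← Matrix.mul_assoc, Matrix.trace_mul_comm, ← Matrix.mul_assoc]
  exact (hA.mul_mul_conjTranspose_same M).trace_nonneg

theorem isSymm_of_isHermitian {p : ℕ} {A : Matrix (Fin p) (Fin p) ℝ} (hA : A.IsHermitian) :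
    A.IsSymm := by
  have := hA.eq
  rwa [conjTranspose_eq_transpose_of_trivial] at this

theorem isHermitian_of_isSymm {p : ℕ} {A : Matrix (Fin p) (Fin p) ℝ} (hA : A.IsSymm) :
    A.IsHermitian := by
  rw [IsHermitian, conjTranspose_eq_transpose_of_trivial]; exact hA

theorem PosDef.quadForm_inv_ge {p : ℕ} {A : Matrix (Fin p) (Fin p) ℝ} (hA : A.PosDef) {c : ℝ}
    (hc : 0 < c) (h : ∀ x : Fin p → ℝ, x ⬝ᵥ A *ᵥ x ≤ c * (x ⬝ᵥ x)) (x : Fin p → ℝ) :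
    c⁻¹ * (x ⬝ᵥ x) ≤ x ⬝ᵥ A⁻¹ *ᵥ x := by
  have hu : IsUnit A.det := (Matrix.isUnit_iff_isUnit_det A).1 hA.isUnit
  -- Expanding `0 ≤ zᵀ A z` gives `xᵀ A⁻¹ x ≥ 2 c⁻¹ xᵀ x - c⁻² xᵀ A x`, which avoids diagonalizing
  -- `A`.
  set z : Fin p → ℝ := A⁻¹ *ᵥ x - c⁻¹ • x
  have h1 : 0 ≤ z ⬝ᵥ A *ᵥ z := by simpa using hA.posSemidef.dotProduct_mulVec_nonneg z
  have hAz : A *ᵥ z = x - c⁻¹ • (A *ᵥ x) := by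
    simp only [z, mulVec_sub, mulVec_smul, mulVec_mulVec]
    rw [Matrix.mul_nonsing_inv _ hu, one_mulVec]
  have h2 : (A⁻¹ *ᵥ x) ⬝ᵥ (A *ᵥ x) = x ⬝ᵥ x := by
    have hs : (A⁻¹)ᵀ = A⁻¹ := isSymm_of_isHermitian hA.inv.isHermitian
    rw [← hs, mulVec_transpose, ← dotProduct_mulVec, mulVec_mulVec,
      Matrix.nonsing_inv_mul _ hu, one_mulVec]
  rw [hAz] at h1
  simp only [z, sub_dotProduct, dotProduct_sub, smul_dotProduct, dotProduct_smul, smul_eq_mul,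
    h2] at h1
  rw [dotProduct_comm (A⁻¹ *ᵥ x) x] at h1
  have h3 : c⁻¹ * (c⁻¹ * (x ⬝ᵥ A *ᵥ x)) ≤ c⁻¹ * (x ⬝ᵥ x) := by
    refine mul_le_mul_of_nonneg_left ?_ (by positivity)
    rw [inv_mul_le_iff₀ hc]; exact h x
  linarith

theorem PosDef.inv_sub_posSemidef {p : ℕ} {A : Matrix (Fin p) (Fin p) ℝ} (hA : A.PosDef) {c : ℝ}
    (hc : 0 < c) (h : specNorm A ≤ c) : (A⁻¹ - c⁻¹ • 1).PosSemidef := by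
  refine PosSemidef.of_dotProduct_mulVec_nonneg ?_ fun x => ?_
  · refine hA.inv.isHermitian.sub (isHermitian_of_isSymm ?_)
    simp [Matrix.IsSymm]
  · have := PosDef.quadForm_inv_ge hA hc (fun x => (le_abs_self _).trans
      ((abs_dotProduct_mulVec_le A x).trans
        (mul_le_mul_of_nonneg_right h (dotProduct_self_nonneg_real x)))) x
    simp only [star_trivial, sub_mulVec, smul_mulVec, one_mulVec, dotProduct_sub,
      dotProduct_smul, smul_eq_mul]
    linarith

theorem trace_mul_eq_sum_of_isSymm {p : ℕ} (A : Matrix (Fin p) (Fin p) ℝ)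
    {D : Matrix (Fin p) (Fin p) ℝ} (hD : D.IsSymm) :
    (A * D).trace = ∑ j, ∑ k, A j k * D j k := by
  simp only [trace, diag_apply, mul_apply]
  refine Finset.sum_congr rfl fun j _ => Finset.sum_congr rfl fun k _ => ?_
  rw [hD.apply]

/-- Each inverse is replaced in turn by its lower bound `b⁻¹` or `a⁻¹`; the error is a trace of a
product of two positive semidefinite matrices. Separate bounds `a` and `b` are what later yields `1
/ (a κ)` instead of `1 / κ²`. -/
theorem trace_inv_mul_inv_mul_ge {p : ℕ} {A B D : Matrix (Fin p) (Fin p) ℝ} (hA : A.PosDef)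
    (hB : B.PosDef) (hD : D.IsSymm) {a b : ℝ} (ha : 0 < a) (hb : 0 < b) (hAa : specNorm A ≤ a)
    (hBb : specNorm B ≤ b) :
    (a * b)⁻¹ * ∑ j, ∑ k, D j k ^ 2 ≤ (A⁻¹ * D * B⁻¹ * D).trace := by
  have hPA := PosDef.inv_sub_posSemidef hA ha hAa
  have hPB := PosDef.inv_sub_posSemidef hB hb hBb
  have hDc : Dᴴ = D := isHermitian_of_isSymm hD
  have h1 : 0 ≤ (A⁻¹ * (D * (B⁻¹ - b⁻¹ • 1) * D)).trace := by
    have := hPB.mul_mul_conjTranspose_same D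
    rw [hDc] at this
    exact PosSemidef.trace_mul_nonneg hA.inv.posSemidef this
  have h2 : 0 ≤ ((A⁻¹ - a⁻¹ • 1) * (D * D)).trace := by
    have := posSemidef_self_mul_conjTranspose D
    rw [hDc] at this
    exact PosSemidef.trace_mul_nonneg hPA this
  have h3 : (D * D).trace = ∑ j, ∑ k, D j k ^ 2 := by
    rw [trace_mul_eq_sum_of_isSymm D hD]; simp_rw [sq]
  have h4 : (A⁻¹ * (D * (B⁻¹ - b⁻¹ • 1) * D)).trace
      = (A⁻¹ * D * B⁻¹ * D).trace - b⁻¹ * (A⁻¹ * (D * D)).trace := by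
    rw [← smul_eq_mul (b⁻¹), ← trace_smul, ← trace_sub]
    congr 1
    simp [Matrix.mul_sub, Matrix.sub_mul, Matrix.mul_assoc]
  have h5 : ((A⁻¹ - a⁻¹ • 1) * (D * D)).trace
      = (A⁻¹ * (D * D)).trace - a⁻¹ * (D * D).trace := by
    rw [← smul_eq_mul (a⁻¹), ← trace_smul, ← trace_sub]
    congr 1
    simp [Matrix.sub_mul]
  rw [← h3, mul_inv]
  have h6 : 0 < b⁻¹ := by positivity
  nlinarith [mul_nonneg h6.le (h5 ▸ h2)]

/-! ### The graphical Lasso loss -/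

theorem hasDerivAt_det_one_add_smul {p : ℕ} (M : Matrix (Fin p) (Fin p) ℝ) :
    HasDerivAt (fun t : ℝ => (1 + t • M).det) M.trace 0 := by
  have h := (Matrix.det (1 + (Polynomial.X : Polynomial ℝ) • M.map Polynomial.C)).hasDerivAt 0
  rw [Matrix.derivative_det_one_add_X_smul] at h
  refine h.congr_of_eventuallyEq (Eventually.of_forall fun t => ?_)
  have := (Polynomial.evalRingHom t).map_det
    (1 + (Polynomial.X : Polynomial ℝ) • M.map Polynomial.C)
  rw [Polynomial.coe_evalRingHom] at this
  simp only [this]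
  congr 1
  ext i j
  by_cases hij : i = j <;> simp [hij, mul_comm t]

theorem hasDerivAt_loss {p : ℕ} (Shat : Matrix (Fin p) (Fin p) ℝ) {Θ : Matrix (Fin p) (Fin p) ℝ}
    (hΘ : Θ.PosDef) (D : Matrix (Fin p) (Fin p) ℝ) :
    HasDerivAt (fun t : ℝ => loss Shat (Θ + t • D)) ((Shat - Θ⁻¹) * D).trace 0 := by
  have hu : IsUnit Θ.det := (Matrix.isUnit_iff_isUnit_det Θ).1 hΘ.isUnit
  have h1 : HasDerivAt (fun t : ℝ => (Shat * (Θ + t • D)).trace) (Shat * D).trace 0 := by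
    have : (fun t : ℝ => (Shat * (Θ + t • D)).trace)
        = fun t => (Shat * Θ).trace + t * (Shat * D).trace := by
      ext t; simp [Matrix.mul_add]
    rw [this]
    simpa using ((hasDerivAt_id (0 : ℝ)).mul_const (Shat * D).trace).const_add (Shat * Θ).trace
  have h2 : HasDerivAt (fun t : ℝ => (Θ + t • D).det) (Θ.det * (Θ⁻¹ * D).trace) 0 := by
    have : (fun t : ℝ => (Θ + t • D).det) = fun t => Θ.det * (1 + t • (Θ⁻¹ * D)).det := by
      ext t
      rw [← det_mul, Matrix.mul_add, Matrix.mul_one, Matrix.mul_smul, ← Matrix.mul_assoc,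
        Matrix.mul_nonsing_inv _ hu, Matrix.one_mul]
    rw [this]
    exact (hasDerivAt_det_one_add_smul _).const_mul _
  have h3 := h2.log (by simpa using hu.ne_zero)
  have h4 := h1.sub h3
  refine h4.congr_deriv ?_
  rw [zero_smul, add_zero, mul_div_cancel_left₀ _ hu.ne_zero, Matrix.sub_mul, trace_sub]

theorem hasDerivAt_loss_line {p : ℕ} (Shat Θ D : Matrix (Fin p) (Fin p) ℝ) {t : ℝ}
    (h : (Θ + t • D).PosDef) :
    HasDerivAt (fun t : ℝ => loss Shat (Θ + t • D)) ((Shat - (Θ + t • D)⁻¹) * D).trace t := by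
  have h0 := hasDerivAt_loss Shat h D
  have h1 : HasDerivAt (fun s : ℝ => s - t) 1 t := (hasDerivAt_id t).sub_const t
  have h2 := HasDerivAt.comp (h := fun s : ℝ => s - t) t ((sub_self t).symm ▸ h0) h1
  rw [mul_one] at h2
  refine h2.congr_of_eventuallyEq (Eventually.of_forall fun s => ?_)
  simp only [Function.comp]
  congr 1
  rw [add_assoc, ← add_smul]; congr 2; ring

theorem PosDef.segment {p : ℕ} {A B : Matrix (Fin p) (Fin p) ℝ} (hA : A.PosDef) (hB : B.PosDef)
    {t : ℝ} (ht : 0 ≤ t) (ht' : t ≤ 1) : (A + t • (B - A)).PosDef := by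
  have h : A + t • (B - A) = (1 - t) • A + t • B := by
    rw [smul_sub, sub_smul, one_smul]; abel
  rw [h]
  rcases ht.eq_or_lt with rfl | ht
  · simpa using hA
  · exact PosDef.posSemidef_add (hA.posSemidef.smul (by linarith)) (hB.smul ht)

theorem inv_sub_inv_eq {p : ℕ} {A B : Matrix (Fin p) (Fin p) ℝ} (hA : IsUnit A.det)
    (hB : IsUnit B.det) : A⁻¹ - B⁻¹ = A⁻¹ * (B - A) * B⁻¹ := by
  rw [Matrix.mul_sub, Matrix.sub_mul, Matrix.mul_assoc, Matrix.mul_nonsing_inv _ hB,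
    Matrix.nonsing_inv_mul _ hA, Matrix.mul_one, Matrix.one_mul]

theorem PosDef.isUnit_det {p : ℕ} {A : Matrix (Fin p) (Fin p) ℝ} (hA : A.PosDef) :
    IsUnit A.det := (Matrix.isUnit_iff_isUnit_det A).1 hA.isUnit

theorem trace_gradient_sub_ge {p : ℕ} {A B : Matrix (Fin p) (Fin p) ℝ} (hA : A.PosDef)
    (hB : B.PosDef) {a b : ℝ} (ha : 0 < a) (hb : 0 < b) (hAa : specNorm A ≤ a)
    (hBb : specNorm B ≤ b) :
    (a * b)⁻¹ * ∑ j, ∑ k, (B - A) j k ^ 2 ≤ ((A⁻¹ - B⁻¹) * (B - A)).trace := by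
  rw [inv_sub_inv_eq (PosDef.isUnit_det hA) (PosDef.isUnit_det hB)]
  exact trace_inv_mul_inv_mul_ge hA hB
    ((isSymm_of_isHermitian hB.isHermitian).sub (isSymm_of_isHermitian hA.isHermitian))
    ha hb hAa hBb

/-- Strong convexity of the loss. -/
theorem loss_sub_ge {p : ℕ} (Shat : Matrix (Fin p) (Fin p) ℝ) {A B : Matrix (Fin p) (Fin p) ℝ}
    (hA : A.PosDef) (hB : B.PosDef) {a b : ℝ} (ha : 0 < a) (hab : a ≤ b) (hAa : specNorm A ≤ a)
    (hBb : specNorm B ≤ b) :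
    ((Shat - A⁻¹) * (B - A)).trace + (a * b)⁻¹ / 2 * ∑ j, ∑ k, (B - A) j k ^ 2
      ≤ loss Shat B - loss Shat A := by
  set D := B - A
  set q := ∑ j, ∑ k, D j k ^ 2
  set g := ((Shat - A⁻¹) * D).trace
  -- The loss along the segment minus its claimed quadratic minorant. Gradient monotonicity between
  -- `A` and `A + t • D` makes it nondecreasing, and its endpoint values give the inequality.
  set F : ℝ → ℝ := fun t => loss Shat (A + t • D) - (g * t + (a * b)⁻¹ / 2 * q * t ^ 2)
  have hd : ∀ t ∈ Set.Icc (0 : ℝ) 1, HasDerivAt F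
      (((Shat - (A + t • D)⁻¹) * D).trace - (g * 1 + (a * b)⁻¹ / 2 * q * ((2 : ℕ) * t ^ (2 - 1)))) t :=
    fun t ht => (hasDerivAt_loss_line Shat A D (PosDef.segment hA hB ht.1 ht.2)).sub
      (((hasDerivAt_id t).const_mul g).add ((hasDerivAt_pow 2 t).const_mul _))
  have hm : MonotoneOn F (Set.Icc 0 1) := by
    refine monotoneOn_of_deriv_nonneg (convex_Icc 0 1)
      (fun t ht => (hd t ht).continuousAt.continuousWithinAt)
      (fun t ht => (hd t (interior_subset ht)).differentiableAt.differentiableWithinAt) ?_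
    intro t ht
    rw [interior_Icc] at ht
    rw [(hd t ⟨ht.1.le, ht.2.le⟩).deriv]
    have hpd := PosDef.segment hA hB ht.1.le ht.2.le
    have hsn : specNorm (A + t • D) ≤ b := by
      have h : A + t • D = (1 - t) • A + t • B := by
        simp only [D]; rw [smul_sub, sub_smul, one_smul]; abel
      rw [h]
      refine (specNorm_add_le _ _).trans ?_
      rw [specNorm_smul, specNorm_smul, abs_of_pos ht.1, abs_of_pos (by linarith [ht.2])]
      nlinarith [ht.1, ht.2]
    have h1 := trace_gradient_sub_ge hA hpd ha (ha.trans_le hab) hAa hsn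
    have h2 : A + t • D - A = t • D := by abel
    rw [h2, Matrix.mul_smul, trace_smul, smul_eq_mul] at h1
    have h3 : ∑ j, ∑ k, (t • D) j k ^ 2 = t ^ 2 * q := by
      simp only [q, Finset.mul_sum, Matrix.smul_apply, smul_eq_mul, mul_pow]
    rw [h3] at h1
    have h4 : (a * b)⁻¹ * (t * q) ≤ ((A⁻¹ - (A + t • D)⁻¹) * D).trace := by
      refine le_of_mul_le_mul_left ?_ ht.1
      linarith
    have h5 : ((Shat - (A + t • D)⁻¹) * D).trace - g = ((A⁻¹ - (A + t • D)⁻¹) * D).trace := by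
      simp only [g]
      rw [← trace_sub, ← Matrix.sub_mul]
      congr 2; abel
    norm_num
    norm_num at h4
    linarith
  have := hm (Set.left_mem_Icc.2 zero_le_one) (Set.right_mem_Icc.2 zero_le_one) zero_le_one
  have hB' : A + (1 : ℝ) • D = B := by simp [D]
  simp only [F, hB', zero_smul, add_zero] at this
  norm_num at this
  norm_num
  linarith

/-! ### Certified solutions of the program -/

/-- `Θ` is positive definite with support in `S` and large entries there, its spectral norm is at
most `a`, and the gradient of the loss at `Θ` vanishes on `S` and is at most `lam / 2`. -/
structure IsCertified {p : ℕ} (μ γ lam a : ℝ) (Shat : Matrix (Fin p) (Fin p) ℝ)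
    (S : Finset (Fin p × Fin p)) (Θ : Matrix (Fin p) (Fin p) ℝ) : Prop where
  posDef : Θ.PosDef
  diag_mem : ∀ j, (j, j) ∈ S
  eq_zero : ∀ j k, (j, k) ∉ S → Θ j k = 0
  large : ∀ j k, (j, k) ∈ S → γ * lam + 4 / μ * lam ≤ |Θ j k|
  grad_eq_zero : ∀ j k, (j, k) ∈ S → (Shat - Θ⁻¹) j k = 0
  grad_le : ∀ j k, |(Shat - Θ⁻¹) j k| ≤ lam / 2
  specNorm_le : specNorm Θ ≤ a

theorem eq_of_sum_sq_nonpos {p : ℕ} {A B : Matrix (Fin p) (Fin p) ℝ} {c : ℝ} (hc : 0 < c)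
    (h : c * ∑ j, ∑ k, (B - A) j k ^ 2 ≤ 0) : B = A := by
  have h0 : ∀ j, 0 ≤ ∑ k, (B - A) j k ^ 2 := fun j => Finset.sum_nonneg fun k _ => sq_nonneg _
  have h1 : ∑ j, ∑ k, (B - A) j k ^ 2 = 0 :=
    le_antisymm (nonpos_of_mul_nonpos_right h hc) (Finset.sum_nonneg fun j _ => h0 j)
  ext j k
  have h2 := (Finset.sum_eq_zero_iff_of_nonneg fun j _ => h0 j).1 h1 j (Finset.mem_univ j)
  have h3 := (Finset.sum_eq_zero_iff_of_nonneg fun k _ => sq_nonneg _).1 h2 k (Finset.mem_univ k)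
  have h4 : (B - A) j k = 0 := by simpa using h3
  rw [Matrix.sub_apply] at h4
  linarith

/-- The loss curvature strictly beats the penalty deficit, since `a κ < κ² = 2 / μ`. -/
theorem half_lt_inv_mul {μ a : ℝ} (hμ : 0 < μ) (ha : 0 < a) (haκ : a < Real.sqrt (2 / μ)) :
    μ / 2 < (a * Real.sqrt (2 / μ))⁻¹ := by
  have hκ : 0 < Real.sqrt (2 / μ) := ha.trans haκ
  have h1 : a * Real.sqrt (2 / μ) < 2 / μ := by
    have := Real.mul_self_sqrt (by positivity : 0 ≤ 2 / μ)
    nlinarith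
  have h2 := (inv_lt_inv₀ (by positivity) (mul_pos ha hκ)).2 h1
  rwa [inv_div] at h2

namespace IsCertified

variable {p : ℕ} {μ γ lam a : ℝ} {ρ : ℝ → ℝ} {Shat : Matrix (Fin p) (Fin p) ℝ}
  {S : Finset (Fin p × Fin p)} {T : Matrix (Fin p) (Fin p) ℝ}

theorem mem_feasible (h : IsCertified μ γ lam a Shat S T) (haκ : a < Real.sqrt (2 / μ)) :
    T ∈ feasible p (Real.sqrt (2 / μ)) :=
  ⟨h.posDef, h.specNorm_le.trans haκ.le⟩

/-- On `S` both gradient and penalty slope vanish; off `S` the one-sided slope `lam |D j k|`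
outweighs a gradient of size at most `lam / 2`. -/
theorem isStationary (h : IsCertified μ γ lam a Shat S T) (hρ : IsAmenableWith μ γ lam ρ)
    (hμ : 0 < μ) (hlam : 0 < lam) (haκ : a < Real.sqrt (2 / μ)) :
    IsStationary Shat ρ (Real.sqrt (2 / μ)) T := by
  refine ⟨h.mem_feasible haκ, fun Θ' hΘ' => ?_⟩
  set D := Θ' - T
  have hD : D.IsSymm := (isSymm_of_isHermitian hΘ'.1.isHermitian).sub
    (isSymm_of_isHermitian h.posDef.isHermitian)
  refine ⟨_, ∑ j, ∑ k, if (j, k) ∈ S then 0 else lam * |D j k|, hasDerivAt_loss Shat h.posDef D,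
    ?_, ?_⟩
  · refine tendsto_finsetSum _ fun j _ => tendsto_finsetSum _ fun k _ => ?_
    by_cases hjk : j = k
    · subst hjk
      simp [h.diag_mem j]
    simp only [hjk, if_false]
    by_cases hS : (j, k) ∈ S
    · simp only [hS, if_true]
      have h1 : 0 < 4 / μ * lam := by positivity
      exact hρ.tendsto_deriv_of_lt (by linarith [h.large j k hS]) _
    · simp only [hS, if_false]
      have := hρ.tendsto_deriv_zero (D j k)
      simpa [h.eq_zero j k hS] using this
  · rw [trace_mul_eq_sum_of_isSymm _ hD, ← Finset.sum_add_distrib]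
    refine Finset.sum_nonneg fun j _ => ?_
    rw [← Finset.sum_add_distrib]
    refine Finset.sum_nonneg fun k _ => ?_
    by_cases hS : (j, k) ∈ S
    · simp [hS, h.grad_eq_zero j k hS]
    · simp only [hS, if_false]
      have h1 := neg_abs_le ((Shat - T⁻¹) j k * D j k)
      rw [abs_mul] at h1
      nlinarith [h.grad_le j k, abs_nonneg (D j k)]

/-- Only the direction `D = T - Θ` is tested. The gradient of the loss at `T` cancels between the
two bounds on `g` and `l`, leaving `0 ≤ (μ / 2 - 1 / (a κ)) ‖D‖_F²`. -/
theorem eq_of_isStationary (h : IsCertified μ γ lam a Shat S T) (hρ : IsAmenableWith μ γ lam ρ)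
    (hμ : 0 < μ) (ha : 0 < a) (haκ : a < Real.sqrt (2 / μ))
    {Θ : Matrix (Fin p) (Fin p) ℝ} (hΘ : IsStationary Shat ρ (Real.sqrt (2 / μ)) Θ) : Θ = T := by
  obtain ⟨hf, hst⟩ := hΘ
  obtain ⟨g, l, hg, hl, hgl⟩ := hst T (h.mem_feasible haκ)
  set D := T - Θ with hDdef
  have hD : D.IsSymm := (isSymm_of_isHermitian h.posDef.isHermitian).sub
    (isSymm_of_isHermitian hf.1.isHermitian)
  have hg' := hg.unique (hasDerivAt_loss Shat hf.1 D)
  have h1 := trace_gradient_sub_ge hf.1 h.posDef (ha.trans haκ) ha hf.2 h.specNorm_le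
  rw [mul_comm (Real.sqrt (2 / μ)), ← hDdef] at h1
  have h2 : g = ((Shat - T⁻¹) * D).trace - ((Θ⁻¹ - T⁻¹) * D).trace := by
    rw [hg', ← trace_sub, ← Matrix.sub_mul]
    congr 2; abel
  have h3 : l ≤ -((Shat - T⁻¹) * D).trace + μ / 2 * ∑ j, ∑ k, D j k ^ 2 := by
    refine le_of_tendsto hl ?_
    filter_upwards [Ioo_mem_nhdsGT (zero_lt_one (α := ℝ))] with t ht
    rw [trace_mul_eq_sum_of_isSymm _ hD, Finset.mul_sum, ← Finset.sum_neg_distrib,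
      ← Finset.sum_add_distrib]
    refine Finset.sum_le_sum fun j _ => ?_
    rw [Finset.mul_sum, ← Finset.sum_neg_distrib, ← Finset.sum_add_distrib]
    refine Finset.sum_le_sum fun k _ => ?_
    by_cases hS : (j, k) ∈ S
    · rw [h.grad_eq_zero j k hS, zero_mul, neg_zero, zero_add]
      split_ifs with hjk
      · positivity
      · have h4 := hρ.support_direction_le hμ (h.large j k hS) ht.1 ht.2 (θ := Θ j k)
        have h5 : 0 ≤ μ / 4 * (T j k - Θ j k) ^ 2 := by positivity
        simp only [hDdef, Matrix.add_apply, Matrix.smul_apply, Matrix.sub_apply, smul_eq_mul]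
        linarith
    · have hjk : j ≠ k := fun hjk => hS (hjk ▸ h.diag_mem j)
      have h4 := hρ.zero_direction_le hμ (θ := Θ j k) (h.grad_le j k) ht.1 ht.2
      have h5 : D j k = 0 - Θ j k := by rw [hDdef, Matrix.sub_apply, h.eq_zero j k hS]
      simp only [hjk, if_false, Matrix.add_apply, Matrix.smul_apply, smul_eq_mul, h5]
      linarith
  have h6 := half_lt_inv_mul hμ ha haκ
  refine (eq_of_sum_sq_nonpos (sub_pos.2 h6) ?_).symm
  rw [sub_mul, ← hDdef]
  linarith

theorem objective_ge (h : IsCertified μ γ lam a Shat S T) (hρ : IsAmenableWith μ γ lam ρ)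
    (hμ : 0 < μ) (hγ : 0 < γ) (hlam : 0 < lam) (ha : 0 < a) (haκ : a < Real.sqrt (2 / μ))
    {Θ : Matrix (Fin p) (Fin p) ℝ} (hΘ : Θ ∈ feasible p (Real.sqrt (2 / μ))) :
    objective Shat ρ T + ((a * Real.sqrt (2 / μ))⁻¹ - μ / 2) / 2 * ∑ j, ∑ k, (Θ - T) j k ^ 2
      ≤ objective Shat ρ Θ := by
  have hD : (Θ - T).IsSymm := (isSymm_of_isHermitian hΘ.1.isHermitian).sub
    (isSymm_of_isHermitian h.posDef.isHermitian)
  have h1 := loss_sub_ge Shat h.posDef hΘ.1 ha haκ.le h.specNorm_le hΘ.2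
  have h2 : penalty ρ T - penalty ρ Θ
      ≤ ((Shat - T⁻¹) * (Θ - T)).trace + μ / 4 * ∑ j, ∑ k, (Θ - T) j k ^ 2 := by
    unfold penalty
    rw [trace_mul_eq_sum_of_isSymm _ hD, Finset.mul_sum, ← Finset.sum_sub_distrib,
      ← Finset.sum_add_distrib]
    refine Finset.sum_le_sum fun j _ => ?_
    rw [Finset.mul_sum, ← Finset.sum_sub_distrib, ← Finset.sum_add_distrib]
    refine Finset.sum_le_sum fun k _ => ?_
    by_cases hS : (j, k) ∈ S
    · rw [h.grad_eq_zero j k hS, zero_mul, zero_add]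
      split_ifs with hjk
      · rw [sub_zero]; positivity
      · have h4 := hρ.support_value_le hμ hγ hlam (h.large j k hS) (θ := Θ j k)
        rw [Matrix.sub_apply]
        linarith [sq_abs (T j k - Θ j k), sq_abs (Θ j k - T j k), abs_sub_comm (T j k) (Θ j k),
          show (T j k - Θ j k) ^ 2 = (Θ j k - T j k) ^ 2 by ring]
    · have hjk : j ≠ k := fun hjk => hS (hjk ▸ h.diag_mem j)
      have h4 := hρ.zero_value_le (θ := Θ j k) (h.grad_le j k)
      simp only [hjk, if_false, Matrix.sub_apply Θ, h.eq_zero j k hS, hρ.zero, sub_zero]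
      linarith
  unfold objective
  linarith

theorem isProgramMinimizer_iff (h : IsCertified μ γ lam a Shat S T)
    (hρ : IsAmenableWith μ γ lam ρ) (hμ : 0 < μ) (hγ : 0 < γ) (hlam : 0 < lam) (ha : 0 < a)
    (haκ : a < Real.sqrt (2 / μ)) (Θ : Matrix (Fin p) (Fin p) ℝ) :
    IsProgramMinimizer Shat ρ (Real.sqrt (2 / μ)) Θ ↔ Θ = T := by
  have h6 := half_lt_inv_mul hμ ha haκ
  have hc : 0 < ((a * Real.sqrt (2 / μ))⁻¹ - μ / 2) / 2 := by linarith
  constructor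
  · rintro ⟨hf, hmin⟩
    have h1 := hmin T (h.mem_feasible haκ)
    have h2 := h.objective_ge hρ hμ hγ hlam ha haκ hf
    exact eq_of_sum_sq_nonpos hc (by linarith)
  · rintro rfl
    refine ⟨h.mem_feasible haκ, fun Θ' hΘ' => ?_⟩
    have h2 := h.objective_ge hρ hμ hγ hlam ha haκ hΘ'
    have h3 : 0 ≤ ((a * Real.sqrt (2 / μ))⁻¹ - μ / 2) / 2 * ∑ j, ∑ k, (Θ' - Θ) j k ^ 2 :=
      mul_nonneg hc.le (Finset.sum_nonneg fun j _ => Finset.sum_nonneg fun k _ => sq_nonneg _)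
    linarith

/-- Oracle competitors have no spectral bound, so the modulus depends on `Θ` through `max a
(specNorm Θ)`; positivity of it is enough for uniqueness. -/
theorem loss_ge (h : IsCertified μ γ lam a Shat S T) (ha : 0 < a)
    {Θ : Matrix (Fin p) (Fin p) ℝ} (hΘ : Θ.PosDef) (hS : supp Θ ⊆ S) :
    loss Shat T + (a * max a (specNorm Θ))⁻¹ / 2 * ∑ j, ∑ k, (Θ - T) j k ^ 2 ≤ loss Shat Θ := by
  have hD : (Θ - T).IsSymm := (isSymm_of_isHermitian hΘ.isHermitian).sub
    (isSymm_of_isHermitian h.posDef.isHermitian)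
  have h1 := loss_sub_ge Shat h.posDef hΘ ha (le_max_left a (specNorm Θ)) h.specNorm_le
    (le_max_right _ _)
  have h2 : ((Shat - T⁻¹) * (Θ - T)).trace = 0 := by
    rw [trace_mul_eq_sum_of_isSymm _ hD]
    refine Finset.sum_eq_zero fun j _ => Finset.sum_eq_zero fun k _ => ?_
    by_cases hjk : (j, k) ∈ S
    · rw [h.grad_eq_zero j k hjk, zero_mul]
    · have h3 : Θ j k = 0 := by
        by_contra h4
        exact hjk (hS (by simp [supp, h4]))
      rw [Matrix.sub_apply Θ, h3, h.eq_zero j k hjk, sub_zero, mul_zero]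
  linarith

theorem isOracle_iff (h : IsCertified μ γ lam a Shat S T) (ha : 0 < a)
    (Θ : Matrix (Fin p) (Fin p) ℝ) : IsOracle Shat S Θ ↔ Θ = T := by
  have hT : supp T ⊆ S := by
    rintro ⟨j, k⟩ hjk
    by_contra h1
    simp [supp, h.eq_zero j k h1] at hjk
  have hc : ∀ Θ : Matrix (Fin p) (Fin p) ℝ, 0 < (a * max a (specNorm Θ))⁻¹ / 2 := fun Θ => by
    have : 0 < max a (specNorm Θ) := ha.trans_le (le_max_left _ _)
    positivity
  constructor
  · rintro ⟨⟨hpd, hS⟩, hmin⟩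
    have h1 := hmin T h.posDef hT
    have h2 := h.loss_ge ha hpd hS
    exact eq_of_sum_sq_nonpos (hc Θ) (by linarith)
  · rintro rfl
    refine ⟨⟨h.posDef, hT⟩, fun Θ' hpd hS => ?_⟩
    have h2 := h.loss_ge ha hpd hS
    have h3 : 0 ≤ (a * max a (specNorm Θ'))⁻¹ / 2 * ∑ j, ∑ k, (Θ' - Θ) j k ^ 2 :=
      mul_nonneg (hc Θ').le (Finset.sum_nonneg fun j _ => Finset.sum_nonneg fun k _ => sq_nonneg _)
    linarith

end IsCertified

/-! ### Maximal row sums -/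

/-- All absolute row sums of `A` are at most `a`. -/
def RowSumLe {m n : Type*} [Fintype n] (A : Matrix m n ℝ) (a : ℝ) : Prop :=
  ∀ i, ∑ j, |A i j| ≤ a

theorem rowSumLe_of_rowSumNorm_le {m n : Type*} [Fintype m] [Fintype n] {A : Matrix m n ℝ} {a : ℝ}
    (h : rowSumNorm A ≤ a) : RowSumLe A a :=
  fun i => (sum_abs_le_rowSumNorm A i).trans h

namespace RowSumLe

variable {l m n : Type*} [Fintype m] [Fintype n]

theorem nonneg [Nonempty l] {A : Matrix l n ℝ} {a : ℝ} (h : RowSumLe A a) : 0 ≤ a :=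
  (Finset.sum_nonneg fun _ _ => abs_nonneg _).trans (h (Classical.arbitrary l))

theorem add {A B : Matrix l n ℝ} {a b : ℝ} (hA : RowSumLe A a) (hB : RowSumLe B b) :
    RowSumLe (A + B) (a + b) := fun i =>
  calc ∑ j, |(A + B) i j| ≤ ∑ j, (|A i j| + |B i j|) :=
        Finset.sum_le_sum fun j _ => abs_add_le _ _
    _ ≤ a + b := by rw [Finset.sum_add_distrib]; exact add_le_add (hA i) (hB i)

theorem neg {A : Matrix l n ℝ} {a : ℝ} (hA : RowSumLe A a) : RowSumLe (-A) a := fun i => by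
  simpa using hA i

theorem mul {A : Matrix l m ℝ} {B : Matrix m n ℝ} {a b : ℝ} (hA : RowSumLe A a)
    (hB : RowSumLe B b) (hb : 0 ≤ b) : RowSumLe (A * B) (a * b) := fun i =>
  calc ∑ j, |(A * B) i j| ≤ ∑ j, ∑ k, |A i k| * |B k j| := by
        refine Finset.sum_le_sum fun j _ => ?_
        rw [mul_apply]
        refine (Finset.abs_sum_le_sum_abs _ _).trans (Finset.sum_le_sum fun k _ => ?_)
        rw [abs_mul]
    _ = ∑ k, |A i k| * ∑ j, |B k j| := by
        rw [Finset.sum_comm]; simp_rw [Finset.mul_sum]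
    _ ≤ ∑ k, |A i k| * b :=
        Finset.sum_le_sum fun k _ => mul_le_mul_of_nonneg_left (hB k) (abs_nonneg _)
    _ ≤ a * b := by rw [← Finset.sum_mul]; exact mul_le_mul_of_nonneg_right (hA i) hb

theorem abs_mulVec_le {A : Matrix l n ℝ} {a : ℝ} (hA : RowSumLe A a) {v : n → ℝ} {r : ℝ}
    (hv : ∀ j, |v j| ≤ r) (hr : 0 ≤ r) (i : l) : |(A *ᵥ v) i| ≤ a * r :=
  calc |(A *ᵥ v) i| ≤ ∑ j, |A i j| * |v j| := by
        refine (Finset.abs_sum_le_sum_abs _ _).trans (Finset.sum_le_sum fun k _ => ?_)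
        rw [abs_mul]
    _ ≤ ∑ j, |A i j| * r :=
        Finset.sum_le_sum fun k _ => mul_le_mul_of_nonneg_left (hv k) (abs_nonneg _)
    _ ≤ a * r := by rw [← Finset.sum_mul]; exact mul_le_mul_of_nonneg_right (hA i) hr

/-- Keeping the middle factor in the entrywise maximum norm costs no factor of dimension or
sparsity. -/
theorem abs_mul_mul_le {k : Type*} {A : Matrix l m ℝ} {E : Matrix m n ℝ} {B : Matrix n k ℝ}
    {a b r : ℝ} (hA : RowSumLe A a) (hE : ∀ i j, |E i j| ≤ r) (hr : 0 ≤ r) (hB : RowSumLe Bᵀ b)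
    (i : l) (j : k) : |(A * E * B) i j| ≤ a * r * b := by
  have h1 : ∀ j, |(A * E) i j| ≤ a * r := fun j => by
    have := hA.abs_mulVec_le (fun k => hE k j) hr i
    simpa [mulVec, dotProduct, mul_apply] using this
  have ha : 0 ≤ a * r := by
    refine mul_nonneg ((Finset.sum_nonneg fun _ _ => abs_nonneg _).trans (hA i)) hr
  have h2 := hB.abs_mulVec_le h1 ha j
  rw [mul_comm]
  simpa [mulVec, dotProduct, mul_apply (M := A * E), mul_comm] using h2

end RowSumLe

theorem rowSumLe_of_support {p d : ℕ} {Θ D : Matrix (Fin p) (Fin p) ℝ} (hd : maxRowNonzero Θ ≤ d)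
    (hD : ∀ j k, (j, k) ∉ supp Θ → D j k = 0) {r : ℝ} (hr : 0 ≤ r) (hDr : ∀ j k, |D j k| ≤ r) :
    RowSumLe D (d * r) := by
  intro i
  have h1 : ∑ j, |D i j| = ∑ j with Θ i j ≠ 0, |D i j| := by
    rw [Finset.sum_filter]
    refine Finset.sum_congr rfl fun j _ => ?_
    split_ifs with h
    · rfl
    · rw [hD i j (by simpa [supp] using h), abs_zero]
  rw [h1]
  have h2 := Finset.sum_le_card_nsmul (Finset.univ.filter fun j => Θ i j ≠ 0) (fun j => |D i j|) r
    fun j _ => hDr i j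
  refine h2.trans ?_
  rw [nsmul_eq_mul]
  refine mul_le_mul_of_nonneg_right ?_ hr
  have h3 : (Finset.univ.filter fun j => Θ i j ≠ 0).card ≤ maxRowNonzero Θ :=
    Finset.le_sup (f := fun j : Fin p => (Finset.univ.filter fun k => Θ j k ≠ 0).card)
      (Finset.mem_univ i)
  exact_mod_cast h3.trans hd

/-! ### Perturbations of the inverse -/

variable {p : ℕ}

/-- A kernel vector `v` would satisfy `v = -Θ⁻¹ D v`, whose sup norm is at most half that of `v`. -/
theorem isUnit_det_add {Θ D : Matrix (Fin p) (Fin p) ℝ} (hΘ : IsUnit Θ.det) {K ε : ℝ}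
    (hK : RowSumLe Θ⁻¹ K) (hD : RowSumLe D ε) (hε : 0 ≤ ε) (h : K * ε ≤ 1 / 2) :
    IsUnit (Θ + D).det := by
  rw [isUnit_iff_ne_zero]
  intro h0
  obtain ⟨v, hv, hv0⟩ := Matrix.exists_mulVec_eq_zero_iff.2 h0
  have h1 : v = -((Θ⁻¹ * D) *ᵥ v) := by
    have h2 : Θ⁻¹ *ᵥ ((Θ + D) *ᵥ v) = 0 := by rw [hv0, mulVec_zero]
    rw [mulVec_mulVec, Matrix.mul_add, Matrix.nonsing_inv_mul _ hΘ, add_mulVec, one_mulVec] at h2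
    exact eq_neg_of_add_eq_zero_left h2
  have h3 : ‖v‖ ≤ 1 / 2 * ‖v‖ := by
    refine (pi_norm_le_iff_of_nonneg (by positivity)).2 fun i => ?_
    have h4 := (hK.mul hD hε).abs_mulVec_le (fun j => norm_le_pi_norm v j) (norm_nonneg v) i
    rw [h1, Pi.neg_apply, norm_neg, Real.norm_eq_abs, ← h1]
    exact h4.trans (mul_le_mul_of_nonneg_right h (norm_nonneg v))
  have h5 : ‖v‖ = 0 := le_antisymm (by linarith) (norm_nonneg v)
  exact hv (norm_eq_zero.1 h5)

theorem inv_add_sub_inv {Θ D : Matrix (Fin p) (Fin p) ℝ} (hΘ : IsUnit Θ.det)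
    (hu : IsUnit (Θ + D).det) : (Θ + D)⁻¹ - Θ⁻¹ = -(Θ⁻¹ * D * (Θ + D)⁻¹) := by
  have := inv_sub_inv_eq hΘ hu
  rw [add_sub_cancel_left] at this
  rw [← this, neg_sub]

/-- In place of a Neumann series, the resolvent identity gives `M ≤ K + K ε M` for the unknown norm
`M`, which is then absorbed. -/
theorem rowSumLe_inv_add {Θ D : Matrix (Fin p) (Fin p) ℝ} (hΘ : IsUnit Θ.det) {K ε : ℝ}
    (hK : RowSumLe Θ⁻¹ K) (hD : RowSumLe D ε) (hε : 0 ≤ ε) (h : K * ε ≤ 1 / 2) :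
    RowSumLe (Θ + D)⁻¹ (2 * K) := by
  intro i
  have : Nonempty (Fin p) := ⟨i⟩
  have hu := isUnit_det_add hΘ hK hD hε h
  set M := rowSumNorm (Θ + D)⁻¹
  have hM : RowSumLe (Θ + D)⁻¹ M := rowSumLe_of_rowSumNorm_le le_rfl
  have h1 : (Θ + D)⁻¹ = Θ⁻¹ + -(Θ⁻¹ * D * (Θ + D)⁻¹) := by
    rw [← inv_add_sub_inv hΘ hu]; abel
  have h2 : RowSumLe (Θ + D)⁻¹ (K + K * ε * M) := by
    rw [h1]; exact hK.add ((hK.mul hD hε).mul hM hM.nonneg).neg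
  have h3 : M ≤ K + K * ε * M := ciSup_le h2
  have h4 : K * ε * M ≤ 1 / 2 * M := mul_le_mul_of_nonneg_right h hM.nonneg
  exact (hM i).trans (by linarith)

theorem rowSumLe_inv_add_sub {Θ D : Matrix (Fin p) (Fin p) ℝ} (hΘ : IsUnit Θ.det) {K ε : ℝ}
    (hK0 : 0 ≤ K) (hK : RowSumLe Θ⁻¹ K) (hD : RowSumLe D ε) (hε : 0 ≤ ε) (h : K * ε ≤ 1 / 2) :
    RowSumLe ((Θ + D)⁻¹ - Θ⁻¹) (K * ε * (2 * K)) := by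
  rw [inv_add_sub_inv hΘ (isUnit_det_add hΘ hK hD hε h)]
  exact ((hK.mul hD hε).mul (rowSumLe_inv_add hΘ hK hD hε h) (by linarith)).neg

/-- The linearization error of `D ↦ (Θ + D)⁻¹` is a contraction near `0`. -/
theorem abs_inv_add_sub_inv_add_le {Θ D D' : Matrix (Fin p) (Fin p) ℝ} (hΘ : IsUnit Θ.det)
    {K ε r : ℝ} (hK0 : 0 ≤ K) (hs : (Θ⁻¹)ᵀ = Θ⁻¹) (hK : RowSumLe Θ⁻¹ K) (hD : RowSumLe D ε)
    (hD' : RowSumLe D' ε) (hDt' : RowSumLe D'ᵀ ε) (hε : 0 ≤ ε) (h : K * ε ≤ 1 / 2) (hr : 0 ≤ r)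
    (hr' : ∀ j k, |(D - D') j k| ≤ r) (j k : Fin p) :
    |(Θ⁻¹ * (D - D') * Θ⁻¹ + ((Θ + D)⁻¹ - (Θ + D')⁻¹)) j k| ≤ 6 * K ^ 3 * ε * r := by
  have hu := isUnit_det_add hΘ hK hD hε h
  have hu' := isUnit_det_add hΘ hK hD' hε h
  have hst : Θᵀ = Θ := by
    have h1 : ((Θ⁻¹)ᵀ)⁻¹ = (Θ⁻¹)⁻¹ := by rw [hs]
    rwa [← transpose_nonsing_inv, Matrix.nonsing_inv_nonsing_inv _ hΘ] at h1
  have hJt : ((Θ + D')⁻¹)ᵀ = (Θ + D'ᵀ)⁻¹ := by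
    rw [transpose_nonsing_inv, transpose_add, hst]
  have h1 : (Θ + D)⁻¹ - (Θ + D')⁻¹ = -((Θ + D)⁻¹ * (D - D') * (Θ + D')⁻¹) := by
    rw [inv_sub_inv_eq hu hu', show Θ + D' - (Θ + D) = -(D - D') by abel, Matrix.mul_neg,
      Matrix.neg_mul]
  -- After telescoping, each term contains one small difference of inverses of size `2 K² ε`. The
  -- terms contribute `4 K³ ε r` and `2 K³ ε r`.
  have h2 : Θ⁻¹ * (D - D') * Θ⁻¹ + ((Θ + D)⁻¹ - (Θ + D')⁻¹)
      = -(((Θ + D)⁻¹ - Θ⁻¹) * (D - D') * (Θ + D')⁻¹)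
        + -(Θ⁻¹ * (D - D') * ((Θ + D')⁻¹ - Θ⁻¹)) := by
    rw [h1]
    simp only [Matrix.sub_mul, Matrix.mul_sub]
    abel
  have h3 := (rowSumLe_inv_add_sub hΘ hK0 hK hD hε h).abs_mul_mul_le hr' hr
    (B := (Θ + D')⁻¹) (by rw [hJt]; exact rowSumLe_inv_add hΘ hK hDt' hε h) j k
  have h4 := hK.abs_mul_mul_le hr' hr (B := (Θ + D')⁻¹ - Θ⁻¹)
    (by rw [transpose_sub, hJt, hs]; exact rowSumLe_inv_add_sub hΘ hK0 hK hDt' hε h) j k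
  rw [h2, Matrix.add_apply]
  refine (abs_add_le _ _).trans ?_
  rw [Matrix.neg_apply, Matrix.neg_apply, abs_neg, abs_neg]
  calc _ ≤ K * ε * (2 * K) * r * (2 * K) + K * r * (K * ε * (2 * K)) := add_le_add h3 h4
    _ = 6 * K ^ 3 * ε * r := by ring

theorem abs_inv_add_sub_le {Θ D : Matrix (Fin p) (Fin p) ℝ} (hΘ : IsUnit Θ.det)
    {K ε r : ℝ} (hK : RowSumLe Θ⁻¹ K) (hst : Θᵀ = Θ) (hD : RowSumLe D ε)
    (hDt : RowSumLe Dᵀ ε) (hε : 0 ≤ ε) (h : K * ε ≤ 1 / 2) (hr : 0 ≤ r)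
    (hr' : ∀ j k, |D j k| ≤ r) (j k : Fin p) :
    |((Θ + D)⁻¹ - Θ⁻¹) j k| ≤ 2 * K ^ 2 * r := by
  rw [inv_add_sub_inv hΘ (isUnit_det_add hΘ hK hD hε h), Matrix.neg_apply, abs_neg]
  have := hK.abs_mul_mul_le hr' hr (B := (Θ + D)⁻¹)
    (by rw [transpose_nonsing_inv, transpose_add, hst]; exact rowSumLe_inv_add hΘ hK hDt hε h) j k
  linarith

/-! ### Solving the restricted score equation -/

/-- The matrix with prescribed entries on `S` and zeros elsewhere. -/
def extend (S : Finset (Fin p × Fin p)) (u : S → ℝ) : Matrix (Fin p) (Fin p) ℝ :=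
  Matrix.of fun j k => if h : (j, k) ∈ S then u ⟨(j, k), h⟩ else 0

theorem extend_apply_mem {S : Finset (Fin p × Fin p)} (u : S → ℝ) (q : S) :
    extend S u q.1.1 q.1.2 = u q := by
  simp [extend]

theorem extend_of_notMem {S : Finset (Fin p × Fin p)} (u : S → ℝ) {j k : Fin p}
    (h : (j, k) ∉ S) : extend S u j k = 0 := by
  simp [extend, h]

theorem abs_extend_le {S : Finset (Fin p × Fin p)} (u : S → ℝ) (j k : Fin p) :
    |extend S u j k| ≤ ‖u‖ := by
  by_cases h : (j, k) ∈ S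
  · have := extend_apply_mem u ⟨(j, k), h⟩
    rw [this]
    exact norm_le_pi_norm u _
  · rw [extend_of_notMem u h, abs_zero]; exact norm_nonneg u

theorem extend_sub {S : Finset (Fin p × Fin p)} (u v : S → ℝ) :
    extend S (u - v) = extend S u - extend S v := by
  ext j k
  by_cases h : (j, k) ∈ S <;> simp [extend, h]

theorem isUnit_hessianSupp {Θ : Matrix (Fin p) (Fin p) ℝ} (hΘ : Θ.PosDef) :
    IsUnit (((Θ ⊗ₖ Θ)⁻¹).submatrix (Subtype.val : supp Θ → Fin p × Fin p) Subtype.val).det := by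
  have h := ((hΘ.kronecker hΘ).inv).submatrix (e := (Subtype.val : supp Θ → Fin p × Fin p))
    Subtype.val_injective
  exact (Matrix.isUnit_iff_isUnit_det _).1 h.isUnit

/-- The Kronecker product acts on vectorized matrices by `D ↦ Θ⁻¹ D Θ⁻¹`, restricted here to
matrices supported on `supp Θ`. -/
theorem hessianSupp_mulVec {Θ : Matrix (Fin p) (Fin p) ℝ} (hs : (Θ⁻¹)ᵀ = Θ⁻¹) (u : supp Θ → ℝ)
    (q : supp Θ) :
    (((Θ ⊗ₖ Θ)⁻¹).submatrix (Subtype.val : supp Θ → Fin p × Fin p) Subtype.val *ᵥ u) q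
      = (Θ⁻¹ * extend (supp Θ) u * Θ⁻¹) q.1.1 q.1.2 := by
  have h1 : (Θ⁻¹ * extend (supp Θ) u * Θ⁻¹) q.1.1 q.1.2
      = ∑ x : Fin p × Fin p, Θ⁻¹ q.1.1 x.1 * Θ⁻¹ q.1.2 x.2 * extend (supp Θ) u x.1 x.2 := by
    rw [Fintype.sum_prod_type, Finset.sum_comm, mul_apply]
    refine Finset.sum_congr rfl fun k _ => ?_
    rw [mul_apply, Finset.sum_mul]
    refine Finset.sum_congr rfl fun j _ => ?_
    rw [← hs, transpose_apply, transpose_apply, transpose_apply, ← transpose_apply (Θ⁻¹) k, hs]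
    ring
  rw [h1, inv_kronecker]
  simp only [mulVec, dotProduct, submatrix_apply, kroneckerMap_apply]
  set F : Fin p × Fin p → ℝ := fun x =>
    Θ⁻¹ q.1.1 x.1 * Θ⁻¹ q.1.2 x.2 * extend (supp Θ) u x.1 x.2
  have h2 : ∑ x ∈ supp Θ, F x = ∑ x, F x :=
    Finset.sum_subset (Finset.subset_univ (supp Θ))
      fun x _ hx => by simp only [F]; rw [extend_of_notMem u hx, mul_zero]
  rw [← h2, ← Finset.sum_coe_sort (supp Θ) F]
  refine Finset.sum_congr rfl fun x _ => ?_
  simp only [F, extend_apply_mem]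

/-- The Newton-type map whose fixed points solve the score equation on the support. -/
noncomputable def newtonMap (Shat Θ : Matrix (Fin p) (Fin p) ℝ) (u : supp Θ → ℝ) : supp Θ → ℝ :=
  u + invHessianSupp Θ *ᵥ fun q => ((Θ + extend (supp Θ) u)⁻¹ - Shat) q.1.1 q.1.2

theorem newtonMap_eq_self_iff {Shat Θ : Matrix (Fin p) (Fin p) ℝ} (hΘ : Θ.PosDef)
    (u : supp Θ → ℝ) : newtonMap Shat Θ u = u ↔
      ∀ j k, (j, k) ∈ supp Θ → (Shat - (Θ + extend (supp Θ) u)⁻¹) j k = 0 := by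
  have hu := isUnit_hessianSupp hΘ
  unfold newtonMap invHessianSupp
  rw [add_eq_left]
  constructor
  · intro h j k hjk
    have h1 := congrArg (fun v =>
      ((Θ ⊗ₖ Θ)⁻¹).submatrix (Subtype.val : supp Θ → Fin p × Fin p) Subtype.val *ᵥ v) h
    simp only [mulVec_mulVec, Matrix.mul_nonsing_inv _ hu, one_mulVec, mulVec_zero] at h1
    have h2 := congrFun h1 ⟨(j, k), hjk⟩
    simp only [Matrix.sub_apply, Pi.zero_apply] at h2 ⊢
    linarith
  · intro h
    rw [show (fun q : supp Θ => ((Θ + extend (supp Θ) u)⁻¹ - Shat) q.1.1 q.1.2) = 0 from ?_,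
      mulVec_zero]
    ext q
    have := h q.1.1 q.1.2 q.2
    simp only [Matrix.sub_apply, Pi.zero_apply] at this ⊢
    linarith

theorem supp_swap {Θ : Matrix (Fin p) (Fin p) ℝ} (hst : Θᵀ = Θ) (j k : Fin p) :
    (k, j) ∈ supp Θ ↔ (j, k) ∈ supp Θ := by
  have : Θ k j = Θ j k := by
    conv_lhs => rw [← hst]
    rfl
  simp [supp, this]

theorem rowSumLe_extend {Θ : Matrix (Fin p) (Fin p) ℝ} {u : supp Θ → ℝ}
    {r : ℝ} (hu : ‖u‖ ≤ r) : RowSumLe (extend (supp Θ) u) (maxRowNonzero Θ * r) :=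
  rowSumLe_of_support le_rfl (fun _ _ h => extend_of_notMem u h) ((norm_nonneg u).trans hu)
    fun j k => (abs_extend_le u j k).trans hu

theorem rowSumLe_extend_transpose {Θ : Matrix (Fin p) (Fin p) ℝ} (hst : Θᵀ = Θ) {u : supp Θ → ℝ}
    {r : ℝ} (hu : ‖u‖ ≤ r) : RowSumLe (extend (supp Θ) u)ᵀ (maxRowNonzero Θ * r) :=
  rowSumLe_of_support le_rfl
    (fun j k h => extend_of_notMem u fun h' => h ((supp_swap hst j k).1 h'))
    ((norm_nonneg u).trans hu) fun j k => (abs_extend_le u k j).trans hu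

/-- The inverse Hessian block turns the linear part of the inversion into exactly `u - v`, so only
the linearization error remains. Since `u` and `v` need not be symmetric, row sums of transposes are
bounded as well. -/
theorem norm_newtonMap_sub_le {Shat Θ : Matrix (Fin p) (Fin p) ℝ} (hΘ : Θ.PosDef)
    {K cinf r : ℝ} (hK0 : 0 ≤ K) (hK : RowSumLe Θ⁻¹ K)
    (hc : RowSumLe (invHessianSupp Θ) cinf) (h1 : K * (maxRowNonzero Θ * r) ≤ 1 / 2)
    (h2 : cinf * (6 * K ^ 3 * (maxRowNonzero Θ * r)) ≤ 1 / 2) {u v : supp Θ → ℝ}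
    (hu : ‖u‖ ≤ r) (hv : ‖v‖ ≤ r) :
    ‖newtonMap Shat Θ u - newtonMap Shat Θ v‖ ≤ 1 / 2 * ‖u - v‖ := by
  have hr : 0 ≤ r := (norm_nonneg u).trans hu
  have hst : Θᵀ = Θ := isSymm_of_isHermitian hΘ.isHermitian
  have hs : (Θ⁻¹)ᵀ = Θ⁻¹ := isSymm_of_isHermitian hΘ.inv.isHermitian
  have hH := isUnit_hessianSupp hΘ
  have h3 : newtonMap Shat Θ u - newtonMap Shat Θ v = invHessianSupp Θ *ᵥ fun q =>
      (Θ⁻¹ * (extend (supp Θ) u - extend (supp Θ) v) * Θ⁻¹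
        + ((Θ + extend (supp Θ) u)⁻¹ - (Θ + extend (supp Θ) v)⁻¹)) q.1.1 q.1.2 := by
    have h4 : u - v = invHessianSupp Θ *ᵥ
        fun q => (Θ⁻¹ * (extend (supp Θ) u - extend (supp Θ) v) * Θ⁻¹) q.1.1 q.1.2 := by
      rw [← extend_sub, ← funext (hessianSupp_mulVec hs (u - v)), invHessianSupp, mulVec_mulVec,
        Matrix.nonsing_inv_mul _ hH, one_mulVec]
    unfold newtonMap
    rw [add_sub_add_comm, ← mulVec_sub]
    conv_lhs => rw [h4]
    rw [← mulVec_add]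
    congr 1
    ext q
    simp only [Pi.add_apply, Pi.sub_apply, Matrix.add_apply, Matrix.sub_apply]
    ring
  rw [h3]
  refine (pi_norm_le_iff_of_nonneg (by positivity)).2 fun q => ?_
  have hd : (0 : ℝ) ≤ maxRowNonzero Θ * r := by positivity
  have h5 := hc.abs_mulVec_le (fun q : supp Θ =>
    abs_inv_add_sub_inv_add_le (PosDef.isUnit_det hΘ) hK0 hs hK (rowSumLe_extend hu)
      (rowSumLe_extend hv) (rowSumLe_extend_transpose hst hv) hd h1 (norm_nonneg (u - v))
      (fun j k => by rw [← extend_sub]; exact abs_extend_le _ j k) q.1.1 q.1.2) (by positivity) q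
  refine h5.trans ?_
  rw [← mul_assoc]
  exact mul_le_mul_of_nonneg_right h2 (norm_nonneg _)

/-- The score equation restricted to the support has a symmetric solution near `Θ`. -/
theorem exists_score_solution {Shat Θ : Matrix (Fin p) (Fin p) ℝ} (hΘ : Θ.PosDef)
    (hSs : Shatᵀ = Shat) {K cinf w r : ℝ} (hK0 : 0 ≤ K) (hK : RowSumLe Θ⁻¹ K) (hc0 : 0 ≤ cinf)
    (hc : RowSumLe (invHessianSupp Θ) cinf) (hw : 0 ≤ w)
    (hSw : ∀ j k, |(Shat - Θ⁻¹) j k| ≤ w) (hr : r = 2 * cinf * w)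
    (h1 : K * (maxRowNonzero Θ * r) ≤ 1 / 2)
    (h2 : cinf * (6 * K ^ 3 * (maxRowNonzero Θ * r)) ≤ 1 / 2) :
    ∃ D : Matrix (Fin p) (Fin p) ℝ, Dᵀ = D ∧ (∀ j k, (j, k) ∉ supp Θ → D j k = 0) ∧
      (∀ j k, |D j k| ≤ r) ∧ ∀ j k, (j, k) ∈ supp Θ → (Shat - (Θ + D)⁻¹) j k = 0 := by
  have hr0 : 0 ≤ r := by rw [hr]; positivity
  have hst : Θᵀ = Θ := isSymm_of_isHermitian hΘ.isHermitian
  have hcon : ∀ {u v : supp Θ → ℝ}, ‖u‖ ≤ r → ‖v‖ ≤ r →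
      ‖newtonMap Shat Θ u - newtonMap Shat Θ v‖ ≤ 1 / 2 * ‖u - v‖ :=
    fun hu hv => norm_newtonMap_sub_le hΘ hK0 hK hc h1 h2 hu hv
  have hext0 : extend (supp Θ) (0 : supp Θ → ℝ) = 0 := by
    ext j k; simp [extend]
  -- The first iterate has size at most `r / 2`; with contraction factor `1 / 2` the ball of radius
  -- `r` is mapped to itself.
  have h0 : ‖newtonMap Shat Θ 0‖ ≤ cinf * w := by
    refine (pi_norm_le_iff_of_nonneg (by positivity)).2 fun q => ?_
    unfold newtonMap
    rw [zero_add, hext0, add_zero]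
    exact hc.abs_mulVec_le (fun q => by
      have := hSw q.1.1 q.1.2
      rwa [Matrix.sub_apply, abs_sub_comm] at this) hw q
  have hmaps : Set.MapsTo (newtonMap Shat Θ) (Metric.closedBall 0 r) (Metric.closedBall 0 r) := by
    intro u hu
    rw [mem_closedBall_zero_iff] at hu ⊢
    have h3 := hcon hu (by simpa using hr0 : ‖(0 : supp Θ → ℝ)‖ ≤ r)
    rw [sub_zero] at h3
    have h4 := norm_le_norm_sub_add (newtonMap Shat Θ u) (newtonMap Shat Θ 0)
    linarith
  have hctr : ContractingWith (1 / 2) (hmaps.restrict _ _ _) := by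
    refine ⟨by norm_num, LipschitzWith.of_dist_le_mul fun x y => ?_⟩
    have := hcon (mem_closedBall_zero_iff.1 x.2) (mem_closedBall_zero_iff.1 y.2)
    rw [Subtype.dist_eq, Subtype.dist_eq, dist_eq_norm, dist_eq_norm]
    simpa using this
  obtain ⟨u, hu, hfix, -⟩ := hctr.exists_fixedPoint' Metric.isClosed_closedBall.isComplete hmaps
    (x := 0) (by simpa using hr0) (edist_ne_top _ _)
  rw [mem_closedBall_zero_iff] at hu
  have hsol := (newtonMap_eq_self_iff hΘ u).1 hfix
  refine ⟨extend (supp Θ) u, ?_, fun j k h => extend_of_notMem u h,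
    fun j k => (abs_extend_le u j k).trans hu, hsol⟩
  -- Symmetry comes from uniqueness: the transposed solution is also a fixed point in the ball.
  set v : supp Θ → ℝ := fun q => u ⟨(q.1.2, q.1.1), (supp_swap hst _ _).2 q.2⟩
  have hv : ‖v‖ ≤ r := (pi_norm_le_iff_of_nonneg hr0).2 fun q => (norm_le_pi_norm u _).trans hu
  have hvu : extend (supp Θ) v = (extend (supp Θ) u)ᵀ := by
    ext j k
    rw [transpose_apply]
    by_cases h : (j, k) ∈ supp Θ
    · have h' := (supp_swap hst j k).2 h
      simp [extend, h, h', v]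
    · have h' : (k, j) ∉ supp Θ := fun h' => h ((supp_swap hst j k).1 h')
      rw [extend_of_notMem _ h, extend_of_notMem _ h']
  have hvfix : newtonMap Shat Θ v = v := by
    refine (newtonMap_eq_self_iff hΘ v).2 fun j k hjk => ?_
    rw [hvu]
    have h3 := hsol k j ((supp_swap hst j k).2 hjk)
    have h4 : (Shat - (Θ + (extend (supp Θ) u)ᵀ)⁻¹) = (Shat - (Θ + extend (supp Θ) u)⁻¹)ᵀ := by
      rw [transpose_sub, transpose_nonsing_inv, transpose_add, hst, hSs]
    rw [h4]
    exact h3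
  have huv : u = v := by
    have h3 := hcon hu hv
    rw [hfix, hvfix] at h3
    exact sub_eq_zero.1 (norm_eq_zero.1 (le_antisymm (by linarith) (norm_nonneg _)))
  rw [← hvu, ← huv]

/-! ### Sub-Gaussian products -/

/-- The moment generating function touches its Gaussian majorant at `0`, so their derivatives there,
the mean and `0`, agree. -/
theorem integral_eq_zero_of_hasSubgaussianMGF {Ω : Type*} [MeasurableSpace Ω] {ν : Measure Ω}
    [IsProbabilityMeasure ν] {X : Ω → ℝ} {c : ℝ≥0} (h : HasSubgaussianMGF X c ν) :
    ∫ ω, X ω ∂ν = 0 := by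
  have h0 : (0 : ℝ) ∈ interior (integrableExpSet X ν) := by
    rw [h.integrableExpSet_eq_univ, interior_univ]; trivial
  have hd : HasDerivAt (mgf X ν) (∫ ω, X ω ∂ν) 0 := by
    have := hasDerivAt_mgf h0
    simpa using this
  have he : HasDerivAt (fun t : ℝ => Real.exp (c * t ^ 2 / 2)) 0 0 := by
    have := (((hasDerivAt_pow 2 (0 : ℝ)).const_mul (c : ℝ)).div_const 2).exp
    simpa using this
  have hmax : IsLocalMax (fun t => mgf X ν t - Real.exp (c * t ^ 2 / 2)) 0 := by
    refine Eventually.of_forall fun t => ?_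
    have := h.mgf_le t
    simp only [mgf_zero]
    norm_num
    linarith
  have := hmax.hasDerivAt_eq_zero (hd.sub he)
  linarith

/-- The square of a sub-Gaussian variable has a finite exponential moment. -/
theorem exists_integral_exp_sq_le {σ : ℝ≥0} (hσ : 0 < σ) :
    ∃ a > 0, ∃ C : ℝ, ∀ (Ω : Type) [MeasurableSpace Ω] (ν : Measure Ω) [IsProbabilityMeasure ν]
      (X : Ω → ℝ), Measurable X → HasSubgaussianMGF X (σ ^ 2) ν →
      Integrable (fun ω => Real.exp (a * X ω ^ 2)) ν ∧ ∫ ω, Real.exp (a * X ω ^ 2) ∂ν ≤ C := by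
  obtain ⟨c, hc, hint⟩ := IsGaussian.exists_integrable_exp_sq (gaussianReal 0 1)
  have hσ' : (0 : ℝ) < σ := hσ
  set G := gaussianReal 0 1
  refine ⟨c / σ ^ 2, by positivity, ∫ g, Real.exp (c * ‖g‖ ^ 2) ∂G, fun Ω _ ν _ X hXm hX => ?_⟩
  set a := c / (σ : ℝ) ^ 2
  have ha : 0 < a := by positivity
  set b := Real.sqrt (2 * a)
  have hb : b ^ 2 = 2 * a := Real.sq_sqrt (by positivity)
  -- Gaussian linearization of the square: `exp (a x²) = E exp (b x g)` when `b² = 2 a`. Exchanging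
  -- the integrals leaves the sub-Gaussian bound at `b g`, whose value is `exp (c g²)`.
  have h1 : ∀ x : ℝ, ENNReal.ofReal (Real.exp (a * x ^ 2))
      = ∫⁻ g, ENNReal.ofReal (Real.exp (b * x * g)) ∂G := by
    intro x
    rw [← ofReal_integral_eq_lintegral_ofReal (integrable_exp_mul_gaussianReal _)
      (Eventually.of_forall fun g => (Real.exp_pos _).le)]
    have := congrFun (mgf_fun_id_gaussianReal (μ := 0) (v := 1)) (b * x)
    rw [mgf] at this
    rw [this, mul_pow, hb]
    congr 2
    norm_num
    ring
  have h2 : ∀ g : ℝ, ∫⁻ ω, ENNReal.ofReal (Real.exp (b * X ω * g)) ∂ν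
      ≤ ENNReal.ofReal (Real.exp (c * ‖g‖ ^ 2)) := by
    intro g
    have h3 : ∀ ω, b * X ω * g = (b * g) * X ω := fun ω => by ring
    simp_rw [h3]
    rw [← ofReal_integral_eq_lintegral_ofReal (hX.integrable_exp_mul _)
      (Eventually.of_forall fun g => (Real.exp_pos _).le)]
    refine ENNReal.ofReal_le_ofReal ((hX.mgf_le (b * g)).trans (Real.exp_le_exp.2 (le_of_eq ?_)))
    rw [mul_pow, hb, Real.norm_eq_abs, sq_abs]
    simp only [a]
    push_cast
    field_simp
  have h4 : ∫⁻ ω, ENNReal.ofReal (Real.exp (a * X ω ^ 2)) ∂ν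
      ≤ ENNReal.ofReal (∫ g, Real.exp (c * ‖g‖ ^ 2) ∂G) := by
    simp_rw [h1]
    rw [lintegral_lintegral_swap (by fun_prop),
      ofReal_integral_eq_lintegral_ofReal hint (Eventually.of_forall fun g => (Real.exp_pos _).le)]
    exact lintegral_mono h2
  have h5 : Integrable (fun ω => Real.exp (a * X ω ^ 2)) ν := by
    refine (lintegral_ofReal_ne_top_iff_integrable (by fun_prop)
      (Eventually.of_forall fun g => (Real.exp_pos _).le)).1 ?_
    exact (h4.trans_lt ENNReal.ofReal_lt_top).ne
  refine ⟨h5, ?_⟩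
  rw [← ofReal_integral_eq_lintegral_ofReal h5 (Eventually.of_forall fun g => (Real.exp_pos _).le)]
    at h4
  exact (ENNReal.ofReal_le_ofReal_iff (integral_nonneg fun g => (Real.exp_pos _).le)).1 h4

theorem exp_le_one_add_add_sq_mul (x : ℝ) : Real.exp x ≤ 1 + x + x ^ 2 * Real.exp |x| := by
  have h := Complex.norm_exp_sub_sum_le_norm_mul_exp (x : ℂ) 2
  simp only [Finset.sum_range_succ, Finset.sum_range_zero] at h
  norm_num at h
  have h2 : (Complex.exp x - (1 + x) : ℂ) = ((Real.exp x - (1 + x) : ℝ) : ℂ) := by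
    push_cast; rfl
  rw [h2, Complex.norm_real, Real.norm_eq_abs] at h
  linarith [le_abs_self (Real.exp x - (1 + x))]

/-- A centred variable with a finite exponential moment is sub-exponential. -/
theorem mgf_le_of_integral_exp_abs_le {Ω : Type*} [MeasurableSpace Ω] {ν : Measure Ω}
    [IsProbabilityMeasure ν] {W : Ω → ℝ} (hW : AEMeasurable W ν) {a C : ℝ} (ha : 0 < a)
    (hint : Integrable (fun ω => Real.exp (a * |W ω|)) ν)
    (hC : ∫ ω, Real.exp (a * |W ω|) ∂ν ≤ C) (h0 : ∫ ω, W ω ∂ν = 0) {s : ℝ} (hs : |s| ≤ a / 2) :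
    Integrable (fun ω => Real.exp (s * W ω)) ν ∧
      mgf W ν s ≤ Real.exp (8 * C / a ^ 2 * s ^ 2) := by
  have hexp : ∀ ω, Real.exp (s * W ω)
      ≤ 1 + s * W ω + s ^ 2 * (8 / a ^ 2) * Real.exp (a * |W ω|) := by
    intro ω
    refine (exp_le_one_add_add_sq_mul _).trans ?_
    have h1 : |s * W ω| ≤ a * |W ω| / 2 := by
      rw [abs_mul]; nlinarith [abs_nonneg (W ω)]
    -- Half of the exponent `a |W|` absorbs the square through `u² / 2 ≤ exp u`; the other half
    -- absorbs `exp |s W|`, since `|s| ≤ a / 2`.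
    have h2 : W ω ^ 2 ≤ 8 / a ^ 2 * Real.exp (a * |W ω| / 2) := by
      have h3 := Real.quadratic_le_exp_of_nonneg (x := a * |W ω| / 2) (by positivity)
      have h5 : 0 ≤ a * |W ω| / 2 := by positivity
      have h4 : a ^ 2 * W ω ^ 2 ≤ 8 * Real.exp (a * |W ω| / 2) := by
        rw [← sq_abs (W ω)]; nlinarith
      rw [div_mul_eq_mul_div, le_div_iff₀ (by positivity)]
      linarith
    have h6 : (s * W ω) ^ 2 * Real.exp |s * W ω|
        ≤ s ^ 2 * (8 / a ^ 2 * Real.exp (a * |W ω| / 2)) * Real.exp (a * |W ω| / 2) := by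
      rw [mul_pow]
      exact mul_le_mul (mul_le_mul_of_nonneg_left h2 (sq_nonneg _)) (Real.exp_le_exp.2 h1)
        (Real.exp_pos _).le (by positivity)
    have h7 : Real.exp (a * |W ω|) = Real.exp (a * |W ω| / 2) * Real.exp (a * |W ω| / 2) := by
      rw [← Real.exp_add]; congr 1; ring
    rw [h7]
    linarith
  have hWi : Integrable W ν := by
    refine (hint.const_mul (1 / a)).mono' hW.aestronglyMeasurable
      (Eventually.of_forall fun ω => ?_)
    have := Real.add_one_le_exp (a * |W ω|)
    rw [Real.norm_eq_abs, one_div, ← div_eq_inv_mul, le_div_iff₀ ha]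
    linarith
  have hadd : Integrable (fun ω => 1 + s * W ω) ν := (integrable_const 1).add (hWi.const_mul s)
  have hb : Integrable (fun ω => 1 + s * W ω + s ^ 2 * (8 / a ^ 2) * Real.exp (a * |W ω|)) ν :=
    hadd.add (hint.const_mul _)
  have hi : Integrable (fun ω => Real.exp (s * W ω)) ν := by
    refine hb.mono' (by fun_prop) (Eventually.of_forall fun ω => ?_)
    rw [Real.norm_eq_abs, abs_of_pos (Real.exp_pos _)]
    exact hexp ω
  refine ⟨hi, ?_⟩
  have h8 : ∫ ω, (1 + s * W ω + s ^ 2 * (8 / a ^ 2) * Real.exp (a * |W ω|)) ∂ν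
      = 1 + s ^ 2 * (8 / a ^ 2) * ∫ ω, Real.exp (a * |W ω|) ∂ν := by
    rw [integral_add hadd (hint.const_mul _),
      integral_add (integrable_const 1) (hWi.const_mul s), integral_const_mul, integral_const_mul,
      h0]
    simp
  calc mgf W ν s ≤ ∫ ω, (1 + s * W ω + s ^ 2 * (8 / a ^ 2) * Real.exp (a * |W ω|)) ∂ν :=
        integral_mono hi hb hexp
    _ ≤ 1 + s ^ 2 * (8 / a ^ 2) * C := by
        rw [h8]
        have := mul_le_mul_of_nonneg_left hC (by positivity : 0 ≤ s ^ 2 * (8 / a ^ 2))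
        linarith
    _ ≤ Real.exp (8 * C / a ^ 2 * s ^ 2) := by
        have := Real.add_one_le_exp (8 * C / a ^ 2 * s ^ 2)
        refine le_trans (le_of_eq ?_) this
        ring

theorem exp_abs_mul_le (a x y : ℝ) (ha : 0 ≤ a) :
    Real.exp (a * |x * y|) ≤ (Real.exp (a * x ^ 2) + Real.exp (a * y ^ 2)) / 2 := by
  have h1 : |x * y| ≤ (x ^ 2 + y ^ 2) / 2 := by
    rw [abs_mul, ← sq_abs x, ← sq_abs y]; nlinarith [sq_nonneg (|x| - |y|)]
  have h2 : Real.exp (a * |x * y|) ≤ Real.exp (a * x ^ 2 / 2) * Real.exp (a * y ^ 2 / 2) := by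
    rw [← Real.exp_add]
    refine Real.exp_le_exp.2 ?_
    nlinarith
  have h3 : ∀ z : ℝ, Real.exp (a * z ^ 2) = Real.exp (a * z ^ 2 / 2) ^ 2 := fun z => by
    rw [sq (Real.exp _), ← Real.exp_add]; congr 1; ring
  rw [h3, h3]
  nlinarith [sq_nonneg (Real.exp (a * x ^ 2 / 2) - Real.exp (a * y ^ 2 / 2))]

/-- Centred products of sub-Gaussian variables are uniformly sub-exponential. -/
theorem exists_mgf_mul_sub_le {σ : ℝ≥0} (hσ : 0 < σ) :
    ∃ a > 0, ∃ B > 0, ∀ (Ω : Type) [MeasurableSpace Ω] (ν : Measure Ω) [IsProbabilityMeasure ν]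
      (X Y : Ω → ℝ), Measurable X → Measurable Y → HasSubgaussianMGF X (σ ^ 2) ν →
      HasSubgaussianMGF Y (σ ^ 2) ν → ∀ s : ℝ, |s| ≤ a →
      Integrable (fun ω => Real.exp (s * (X ω * Y ω - ∫ ω, X ω * Y ω ∂ν))) ν ∧
      mgf (fun ω => X ω * Y ω - ∫ ω, X ω * Y ω ∂ν) ν s ≤ Real.exp (B * s ^ 2) := by
  obtain ⟨a, ha, C, hC⟩ := exists_integral_exp_sq_le hσ
  -- Centring costs a factor `exp (a |m|) ≤ exp |C|`; replacing `C` by `|C| + 1` makes positivity of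
  -- the constant immediate.
  refine ⟨a / 2, by positivity, 8 * (Real.exp |C| * (|C| + 1)) / a ^ 2, by positivity,
    fun Ω _ ν _ X Y hXm hYm hX hY s hs => ?_⟩
  obtain ⟨hX1, hX2⟩ := hC Ω ν X hXm hX
  obtain ⟨hY1, hY2⟩ := hC Ω ν Y hYm hY
  set m := ∫ ω, X ω * Y ω ∂ν
  have hZb : Integrable (fun ω => (Real.exp (a * X ω ^ 2) + Real.exp (a * Y ω ^ 2)) / 2) ν :=
    (hX1.add hY1).div_const 2
  have hZe : Integrable (fun ω => Real.exp (a * |X ω * Y ω|)) ν := by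
    refine hZb.mono' (by fun_prop) (Eventually.of_forall fun ω => ?_)
    rw [Real.norm_eq_abs, abs_of_pos (Real.exp_pos _)]
    exact exp_abs_mul_le a _ _ ha.le
  have hZC : ∫ ω, Real.exp (a * |X ω * Y ω|) ∂ν ≤ C := by
    refine (integral_mono hZe hZb fun ω => exp_abs_mul_le a _ _ ha.le).trans ?_
    rw [integral_div, integral_add hX1 hY1]
    linarith
  have hbd : ∀ ω, a * |X ω * Y ω| ≤ Real.exp (a * |X ω * Y ω|) := fun ω => by
    linarith [Real.add_one_le_exp (a * |X ω * Y ω|)]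
  have hZi : Integrable (fun ω => X ω * Y ω) ν := by
    refine (hZe.const_mul (1 / a)).mono' (by fun_prop) (Eventually.of_forall fun ω => ?_)
    rw [Real.norm_eq_abs, one_div, ← div_eq_inv_mul, le_div_iff₀ ha]
    linarith [hbd ω]
  have hm : a * |m| ≤ C := by
    calc a * |m| ≤ a * ∫ ω, |X ω * Y ω| ∂ν :=
          mul_le_mul_of_nonneg_left abs_integral_le_integral_abs ha.le
      _ = ∫ ω, a * |X ω * Y ω| ∂ν := (integral_const_mul _ _).symm
      _ ≤ ∫ ω, Real.exp (a * |X ω * Y ω|) ∂ν := integral_mono (hZi.abs.const_mul a) hZe hbd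
      _ ≤ C := hZC
  have hWle : ∀ ω, Real.exp (a * |X ω * Y ω - m|)
      ≤ Real.exp |C| * Real.exp (a * |X ω * Y ω|) := fun ω => by
    rw [← Real.exp_add]
    refine Real.exp_le_exp.2 ?_
    have := abs_sub (X ω * Y ω) m
    nlinarith [le_abs_self C]
  have hWe : Integrable (fun ω => Real.exp (a * |X ω * Y ω - m|)) ν := by
    refine (hZe.const_mul (Real.exp |C|)).mono' (by fun_prop) (Eventually.of_forall fun ω => ?_)
    rw [Real.norm_eq_abs, abs_of_pos (Real.exp_pos _)]
    exact hWle ω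
  have hWC : ∫ ω, Real.exp (a * |X ω * Y ω - m|) ∂ν ≤ Real.exp |C| * (|C| + 1) := by
    refine (integral_mono hWe (hZe.const_mul _) hWle).trans ?_
    rw [integral_const_mul]
    exact mul_le_mul_of_nonneg_left (by linarith [le_abs_self C]) (Real.exp_pos _).le
  have hW0 : ∫ ω, (X ω * Y ω - m) ∂ν = 0 := by
    rw [integral_sub hZi (integrable_const _)]
    simp [m]
  exact mgf_le_of_integral_exp_abs_le (by fun_prop) ha hWe hWC hW0 hs

/-- Bernstein-type tail bound for an average of i.i.d. sub-exponential variables. -/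
theorem measureReal_abs_sum_ge_le {Ω : Type*} [MeasurableSpace Ω] {P : Measure Ω}
    [IsProbabilityMeasure P] {n : ℕ} {W : Fin n → Ω → ℝ} (hind : iIndepFun W P)
    (hm : ∀ i, AEMeasurable (W i) P) {a B : ℝ} (hB : 0 < B)
    (h : ∀ i (s : ℝ), |s| ≤ a → Integrable (fun ω => Real.exp (s * W i ω)) P ∧
      mgf (W i) P s ≤ Real.exp (B * s ^ 2)) {t : ℝ} (ht : 0 ≤ t) (hta : t ≤ 2 * B * a) :
    P.real {ω | n * t ≤ |∑ i, W i ω|} ≤ 2 * Real.exp (-(n * t ^ 2 / (4 * B))) := by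
  -- The minimizer of the Chernoff exponent `-s t + B s²`.
  set s := t / (2 * B)
  have hs0 : 0 ≤ s := by positivity
  have hsa : s ≤ a := by
    rw [div_le_iff₀ (by positivity)]; linarith
  have hmgf : ∀ s : ℝ, |s| ≤ a → mgf (∑ i, W i) P s ≤ Real.exp (n * (B * s ^ 2)) := by
    intro s hs
    rw [hind.mgf_sum₀ hm]
    refine (Finset.prod_le_prod (fun i _ => mgf_nonneg) fun i _ => (h i s hs).2).trans ?_
    rw [Finset.prod_const, Finset.card_univ, Fintype.card_fin, ← Real.exp_nat_mul]
  have hint : ∀ s : ℝ, |s| ≤ a → Integrable (fun ω => Real.exp (s * (∑ i, W i) ω)) P := by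
    intro s hs
    rw [← mgf_pos_iff, hind.mgf_sum₀ hm]
    exact Finset.prod_pos fun i _ => mgf_pos (h i s hs).1
  have hs1 : |s| ≤ a := by rwa [abs_of_nonneg hs0]
  have hs2 : |-s| ≤ a := by rwa [abs_neg]
  have hval : -s * (n * t) + n * (B * s ^ 2) = -(n * t ^ 2 / (4 * B)) := by
    simp only [s]; field_simp; ring
  have h1 : P.real {ω | n * t ≤ (∑ i, W i) ω} ≤ Real.exp (-(n * t ^ 2 / (4 * B))) := by
    refine (measure_ge_le_exp_mul_mgf _ hs0 (hint s hs1)).trans ?_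
    rw [← hval, Real.exp_add]
    exact mul_le_mul_of_nonneg_left (hmgf s hs1) (Real.exp_pos _).le
  have h2 : P.real {ω | (∑ i, W i) ω ≤ -(n * t)} ≤ Real.exp (-(n * t ^ 2 / (4 * B))) := by
    refine (measure_le_le_exp_mul_mgf _ (neg_nonpos.2 hs0) (hint (-s) hs2)).trans ?_
    rw [← hval, Real.exp_add]
    have := hmgf (-s) hs2
    rw [neg_sq] at this
    rw [neg_neg, mul_neg, ← neg_mul]
    exact mul_le_mul_of_nonneg_left this (Real.exp_pos _).le
  have h3 : {ω | n * t ≤ |∑ i, W i ω|}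
      ⊆ {ω | n * t ≤ (∑ i, W i) ω} ∪ {ω | (∑ i, W i) ω ≤ -(n * t)} := by
    intro ω hω
    simp only [Set.mem_ofPred_eq, Set.mem_union, Finset.sum_apply] at hω ⊢
    rcases le_abs.1 hω with h | h
    · exact Or.inl h
    · exact Or.inr (by linarith)
  calc P.real {ω | n * t ≤ |∑ i, W i ω|} ≤ _ := measureReal_mono h3
    _ ≤ _ := measureReal_union_le _ _
    _ ≤ 2 * Real.exp (-(n * t ^ 2 / (4 * B))) := by linarith

/-! ### Deviations of the sample covariance matrix -/

theorem IsSubGaussianLaw.hasSubgaussianMGF_apply {p : ℕ} {σ : ℝ≥0} {ν : Measure (Fin p → ℝ)}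
    (h : IsSubGaussianLaw σ ν) (j : Fin p) : HasSubgaussianMGF (fun x => x j) (σ ^ 2) ν := by
  have := h (Pi.single j 1) (by simp)
  simpa using this

theorem covMat_apply_eq {p : ℕ} {σ : ℝ≥0} {ν : Measure (Fin p → ℝ)} [IsProbabilityMeasure ν]
    (h : IsSubGaussianLaw σ ν) (j k : Fin p) : covMat ν j k = ∫ x, x j * x k ∂ν := by
  simp [covMat, covariance, integral_eq_zero_of_hasSubgaussianMGF (h.hasSubgaussianMGF_apply j),
    integral_eq_zero_of_hasSubgaussianMGF (h.hasSubgaussianMGF_apply k)]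

theorem sampleCov_transpose {n p : ℕ} (x : Fin n → Fin p → ℝ) :
    (sampleCov x)ᵀ = sampleCov x := by
  ext j k
  simp [sampleCov, Matrix.sum_apply, vecMulVec_apply, mul_comm]

theorem sampleCov_apply {n p : ℕ} (x : Fin n → Fin p → ℝ) (j k : Fin p) :
    sampleCov x j k = 1 / n * ∑ i, x i j * x i k := by
  simp [sampleCov, Matrix.sum_apply, vecMulVec_apply]

theorem exists_sampleCov_tail {σ : ℝ≥0} (hσ : 0 < σ) :
    ∃ a > 0, ∃ B > 0, ∀ (n p : ℕ) (ν : Measure (Fin p → ℝ)) [IsProbabilityMeasure ν]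
      (Ω : Type*) [MeasurableSpace Ω] (P : Measure Ω) [IsProbabilityMeasure P]
      (X : Fin n → Ω → Fin p → ℝ), 0 < n →
      iIndepFun X P → (∀ i, HasLaw (X i) ν P) → IsSubGaussianLaw σ ν →
      ∀ t, 0 ≤ t → t ≤ 2 * B * a → ∀ j k,
        P.real {ω | t ≤ |(sampleCov (fun i => X i ω) - covMat ν) j k|}
          ≤ 2 * Real.exp (-(n * t ^ 2 / (4 * B))) := by
  obtain ⟨a, ha, B, hB, hmgf⟩ := exists_mgf_mul_sub_le hσ
  refine ⟨a, ha, B, hB, fun n p ν _ Ω _ P _ X hn hind hlaw hsub t ht hta j k => ?_⟩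
  set m := ∫ x, x j * x k ∂ν with hm
  set f : (Fin p → ℝ) → ℝ := fun x => x j * x k - m
  have hf : Measurable f := by fun_prop
  have hW : ∀ i (s : ℝ), |s| ≤ a → Integrable (fun ω => Real.exp (s * (f ∘ X i) ω)) P ∧
      mgf (f ∘ X i) P s ≤ Real.exp (B * s ^ 2) := by
    intro i s hs
    obtain ⟨h1, h2⟩ := hmgf _ ν (fun x => x j) (fun x => x k) (measurable_pi_apply j)
      (measurable_pi_apply k) (hsub.hasSubgaussianMGF_apply j) (hsub.hasSubgaussianMGF_apply k) s hs
    have hmeas : AEStronglyMeasurable (fun x => Real.exp (s * f x)) ν := by fun_prop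
    constructor
    · have h3 : Integrable (fun x => Real.exp (s * f x)) (P.map (X i)) := by
        rw [(hlaw i).map_eq]; exact h1
      exact h3.comp_aemeasurable (hlaw i).aemeasurable
    · refine le_trans (le_of_eq ?_) h2
      exact (hlaw i).integral_comp hmeas
  have h3 := measureReal_abs_sum_ge_le (hind.comp (fun _ => f) fun _ => hf)
    (fun i => hf.comp_aemeasurable (hlaw i).aemeasurable) hB hW ht hta
  refine le_trans (le_of_eq ?_) h3
  congr 1
  ext ω
  have hn' : (0 : ℝ) < n := by exact_mod_cast hn
  have h4 : (sampleCov (fun i => X i ω) - covMat ν) j k = 1 / n * ∑ i, (f ∘ X i) ω := by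
    rw [Matrix.sub_apply, sampleCov_apply, covMat_apply_eq hsub]
    simp only [f, Function.comp, Finset.sum_sub_distrib, Finset.sum_const, Finset.card_univ,
      Fintype.card_fin, nsmul_eq_mul]
    field_simp
    rw [hm]
  simp only [Set.mem_ofPred_eq]
  rw [h4, abs_mul, abs_of_pos (by positivity : 0 < 1 / (n : ℝ)), one_div, ← div_eq_inv_mul,
    le_div_iff₀ hn', mul_comm t]

/-- With high probability the sample covariance matrix is entrywise close to the covariance. -/
theorem exists_sampleCov_event {σ : ℝ≥0} (hσ : 0 < σ) :
    ∃ b > 0, ∃ C > 0, ∀ (n p : ℕ) (ν : Measure (Fin p → ℝ)) [IsProbabilityMeasure ν]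
      (Ω : Type*) [MeasurableSpace Ω] (P : Measure Ω) [IsProbabilityMeasure P]
      (X : Fin n → Ω → Fin p → ℝ), 0 < n → 0 < p →
      iIndepFun X P → (∀ i, HasLaw (X i) ν P) → IsSubGaussianLaw σ ν →
      Real.sqrt (Real.log p / n) ≤ b →
      ∃ E : Set Ω, MeasurableSet E ∧ 1 - 2 * Real.exp (-Real.log p) ≤ P.real E ∧
        ∀ ω ∈ E, ∀ j k, |(sampleCov (fun i => X i ω) - covMat ν) j k|
          ≤ C * Real.sqrt (Real.log p / n) := by
  obtain ⟨a, ha, B, hB, htail⟩ := exists_sampleCov_tail hσ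
  -- The constant `12 B` makes the tail exponent `3 log p`: the union bound over `p²` entries uses
  -- `2 log p`, and `log p` is left.
  have hC : 0 < Real.sqrt (12 * B) := Real.sqrt_pos.2 (by positivity)
  refine ⟨2 * B * a / Real.sqrt (12 * B), by positivity, Real.sqrt (12 * B), hC,
    fun n p ν _ Ω _ P _ X hn hp hind hlaw hsub hR => ?_⟩
  set t := Real.sqrt (12 * B) * Real.sqrt (Real.log p / n)
  have ht : 0 ≤ t := by positivity
  have hta : t ≤ 2 * B * a := by
    rw [le_div_iff₀ hC] at hR
    linarith
  have hn' : (0 : ℝ) < n := by exact_mod_cast hn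
  have hp' : (0 : ℝ) < p := by exact_mod_cast hp
  have hlog : 0 ≤ Real.log p := Real.log_natCast_nonneg p
  set bad : Set Ω := ⋃ q : Fin p × Fin p,
    {ω | t ≤ |(sampleCov (fun i => X i ω) - covMat ν) q.1 q.2|}
  have hbad : P.real bad ≤ 2 * Real.exp (-Real.log p) := by
    calc P.real bad ≤ ∑ q : Fin p × Fin p,
          P.real {ω | t ≤ |(sampleCov (fun i => X i ω) - covMat ν) q.1 q.2|} :=
          measureReal_iUnion_fintype_le _
      _ ≤ ∑ _q : Fin p × Fin p, 2 * Real.exp (-(n * t ^ 2 / (4 * B))) :=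
          Finset.sum_le_sum fun q _ => htail n p ν Ω P X hn hind hlaw hsub t ht hta q.1 q.2
      _ = 2 * Real.exp (-Real.log p) := by
          have h1 : n * t ^ 2 / (4 * B) = 3 * Real.log p := by
            simp only [t]
            rw [mul_pow, Real.sq_sqrt (by positivity), Real.sq_sqrt (by positivity)]
            field_simp
            ring
          rw [h1, Finset.sum_const, Finset.card_univ, Fintype.card_prod, Fintype.card_fin,
            nsmul_eq_mul]
          push_cast
          have h2 : (p : ℝ) * p = Real.exp (2 * Real.log p) := by
            rw [two_mul, Real.exp_add, Real.exp_log hp']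
          rw [h2, mul_left_comm, ← Real.exp_add]
          congr 2
          ring
  -- The data are only almost everywhere measurable, so the bad set is enlarged to a measurable hull
  -- of the same measure.
  refine ⟨(toMeasurable P bad)ᶜ, (measurableSet_toMeasurable P bad).compl, ?_, ?_⟩
  · rw [probReal_compl_eq_one_sub (measurableSet_toMeasurable P bad)]
    have : P.real (toMeasurable P bad) = P.real bad := by
      simp only [Measure.real, measure_toMeasurable]
    linarith
  · intro ω hω j k
    by_contra hlt
    exact hω (subset_toMeasurable P bad (Set.mem_iUnion.2 ⟨(j, k), (not_le.1 hlt).le⟩))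

/-! ### Construction of the certified solution -/

theorem sum_sq_le_card_mul {p : ℕ} {S : Finset (Fin p × Fin p)} {D : Matrix (Fin p) (Fin p) ℝ}
    (hD : ∀ j k, (j, k) ∉ S → D j k = 0) {r : ℝ} (hr : ∀ j k, |D j k| ≤ r) :
    ∑ j, ∑ k, D j k ^ 2 ≤ S.card * r ^ 2 := by
  have h1 : ∑ j, ∑ k, D j k ^ 2 = ∑ q : Fin p × Fin p, D q.1 q.2 ^ 2 :=
    (Fintype.sum_prod_type fun q : Fin p × Fin p => D q.1 q.2 ^ 2).symm
  rw [h1, ← Finset.sum_subset (Finset.subset_univ S) fun q _ hq => by rw [hD _ _ hq]; norm_num,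
    ← nsmul_eq_mul]
  refine Finset.sum_le_card_nsmul _ _ _ fun q _ => ?_
  exact sq_le_sq' (abs_le.1 (hr _ _)).1 (abs_le.1 (hr _ _)).2

/-- The quadratic form of `Θ` is at least `1 / K`, while that of `D` is at most `1 / (2 K)` in
absolute value. -/
theorem PosDef.add_of_specNorm_le {p : ℕ} {Θ D : Matrix (Fin p) (Fin p) ℝ} (hΘ : Θ.PosDef)
    (hD : D.IsSymm) {K : ℝ} (hK0 : 0 < K) (hK : specNorm Θ⁻¹ ≤ K)
    (h : K * specNorm D ≤ 1 / 2) : (Θ + D).PosDef := by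
  refine PosDef.of_dotProduct_mulVec_pos (hΘ.isHermitian.add (isHermitian_of_isSymm hD))
    fun x hx => ?_
  have hx0 : 0 < x ⬝ᵥ x := by
    rw [← norm_toLp_sq]
    have : WithLp.toLp 2 x ≠ 0 := by simpa using hx
    positivity
  have h1 := PosDef.quadForm_inv_ge hΘ.inv hK0 (fun x => (le_abs_self _).trans
      ((abs_dotProduct_mulVec_le Θ⁻¹ x).trans
        (mul_le_mul_of_nonneg_right hK (dotProduct_self_nonneg_real x)))) x
  rw [Matrix.nonsing_inv_nonsing_inv _ (PosDef.isUnit_det hΘ)] at h1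
  have h2 := (abs_le.1 (abs_dotProduct_mulVec_le D x)).1
  rw [star_trivial, add_mulVec, dotProduct_add]
  have h3 : specNorm D < K⁻¹ := by
    rw [← one_div, lt_div_iff₀ hK0]; linarith
  nlinarith

theorem one_le_maxRowNonzero {p : ℕ} {Θ : Matrix (Fin p) (Fin p) ℝ} (hΘ : Θ.PosDef)
    (hp : 0 < p) : 1 ≤ maxRowNonzero Θ := by
  have h1 : (Finset.univ.filter fun k : Fin p => Θ ⟨0, hp⟩ k ≠ 0).card ≤ maxRowNonzero Θ :=
    Finset.le_sup (f := fun j : Fin p => (Finset.univ.filter fun k => Θ j k ≠ 0).card)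
      (Finset.mem_univ _)
  refine le_trans ?_ h1
  rw [Nat.one_le_iff_ne_zero, ← Nat.pos_iff_ne_zero, Finset.card_pos]
  exact ⟨⟨0, hp⟩, by simpa using hΘ.diag_pos.ne'⟩

/-- The deterministic core, driven only by the entrywise error `w`. Off the support the gradient is
bounded crudely by `w` plus the entrywise change `2 K² r` of the inverse, so a large enough `lam`
replaces any incoherence condition. The extra `r` in the signal bound pays for the shift from `Θ` to
`T`. -/
theorem exists_isCertified {p : ℕ} {Shat Θ : Matrix (Fin p) (Fin p) ℝ} (hΘ : Θ.PosDef)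
    (hSs : Shatᵀ = Shat) {μ γ lam κ₀ a K cinf w r : ℝ} (hK0 : 0 < K)
    (hK : rowSumNorm Θ⁻¹ ≤ K) (hc0 : 0 ≤ cinf) (hc : rowSumNorm (invHessianSupp Θ) ≤ cinf)
    (hw : 0 ≤ w) (hSw : ∀ j k, |(Shat - Θ⁻¹) j k| ≤ w) (hr : r = 2 * cinf * w)
    (h1 : K * (maxRowNonzero Θ * r) ≤ 1 / 2)
    (h2 : cinf * (6 * K ^ 3 * (maxRowNonzero Θ * r)) ≤ 1 / 2)
    (hκ : specNorm Θ ≤ κ₀) (ha : κ₀ + maxRowNonzero Θ * r ≤ a)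
    (hlam : w + 2 * K ^ 2 * r ≤ lam / 2)
    (hmin : ∀ j k, Θ j k ≠ 0 → γ * lam + 4 / μ * lam + r ≤ |Θ j k|) :
    ∃ T : Matrix (Fin p) (Fin p) ℝ, IsCertified μ γ lam a Shat (supp Θ) T ∧
      (∀ j k, |T j k - Θ j k| ≤ r) ∧
      frobNorm (T - Θ) ≤ Real.sqrt (numNonzero Θ) * r ∧
      specNorm (T - Θ) ≤ min (Real.sqrt (numNonzero Θ)) (maxRowNonzero Θ) * r := by
  have hr0 : 0 ≤ r := by rw [hr]; positivity
  have hK' := rowSumLe_of_rowSumNorm_le hK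
  have hst : Θᵀ = Θ := isSymm_of_isHermitian hΘ.isHermitian
  have hs : (Θ⁻¹)ᵀ = Θ⁻¹ := isSymm_of_isHermitian hΘ.inv.isHermitian
  obtain ⟨D, hDt, hDS, hDr, hscore⟩ := exists_score_solution hΘ hSs hK0.le hK' hc0
    (rowSumLe_of_rowSumNorm_le hc) hw hSw hr h1 h2
  have hdr : (0 : ℝ) ≤ maxRowNonzero Θ * r := by positivity
  have hDrow : RowSumLe D (maxRowNonzero Θ * r) := rowSumLe_of_support le_rfl hDS hr0 hDr
  have hDcol : RowSumLe Dᵀ (maxRowNonzero Θ * r) := by rwa [hDt]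
  have hDspec : specNorm D ≤ maxRowNonzero Θ * r :=
    specNorm_le_of_sum_abs_le hdr hDrow hDcol
  have hDfrob : frobNorm D ≤ Real.sqrt (numNonzero Θ) * r := by
    unfold frobNorm
    refine Real.sqrt_le_iff.2 ⟨by positivity, ?_⟩
    rw [mul_pow, Real.sq_sqrt (by positivity)]
    exact sum_sq_le_card_mul hDS hDr
  have hKs : specNorm Θ⁻¹ ≤ K := by
    refine specNorm_le_of_sum_abs_le hK0.le hK' ?_
    have : RowSumLe (Θ⁻¹)ᵀ K := by rwa [hs]
    exact this
  have hpd : (Θ + D).PosDef := PosDef.add_of_specNorm_le hΘ hDt hK0 hKs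
    ((mul_le_mul_of_nonneg_left hDspec hK0.le).trans h1)
  have hsub : Θ + D - Θ = D := by abel
  refine ⟨Θ + D, ⟨hpd, fun j => ?_, fun j k h => ?_, fun j k h => ?_, hscore, fun j k => ?_, ?_⟩,
    fun j k => ?_, ?_, ?_⟩
  · simpa [supp] using hΘ.diag_pos.ne'
  · rw [Matrix.add_apply, hDS j k h, add_zero]
    simpa [supp] using h
  · have h3 := hmin j k (by simpa [supp] using h)
    have h4 := abs_sub_abs_le_abs_sub (Θ j k) (-D j k)
    rw [abs_neg, sub_neg_eq_add] at h4
    rw [Matrix.add_apply]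
    linarith [hDr j k]
  · have h3 := abs_inv_add_sub_le (PosDef.isUnit_det hΘ) hK' hst hDrow hDcol hdr h1 hr0 hDr j k
    have h4 : (Shat - (Θ + D)⁻¹) j k = (Shat - Θ⁻¹) j k - ((Θ + D)⁻¹ - Θ⁻¹) j k := by
      simp only [Matrix.sub_apply]; ring
    rw [h4]
    have h5 := abs_sub ((Shat - Θ⁻¹) j k) (((Θ + D)⁻¹ - Θ⁻¹) j k)
    linarith [hSw j k]
  · exact (specNorm_add_le _ _).trans ((add_le_add hκ hDspec).trans ha)
  · rw [Matrix.add_apply, add_sub_cancel_left]; exact hDr j k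
  · rw [hsub]; exact hDfrob
  · rw [hsub, min_mul_of_nonneg _ _ hr0]
    exact le_min ((specNorm_le_frobNorm D).trans hDfrob) hDspec

end GLasso

/-! ### Choice of constants and conclusion -/

theorem mainTheorem6
    (σ : ℝ≥0) (cinf K μ κ₀ : ℝ) (hσ : 0 < σ) (hcinf : 0 < cinf) (hK : 0 < K) (hμ : 0 < μ)
    (hκ₀ : 0 < κ₀) (hκ₀' : κ₀ < Real.sqrt (2 / μ)) :
    ∃ cl > 0, ∃ c₀ > 0, ∃ c₁ > 0, ∃ c₂ > 0, ∃ c₃ > 0, ∀ cu : ℝ, cl ≤ cu → ∃ cβ ≥ c₃,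
    ∀ (n p : ℕ) (γ lam : ℝ) (ρ : ℝ → ℝ) (ν : Measure (Fin p → ℝ)) [IsProbabilityMeasure ν]
      (Ω : Type*) [MeasurableSpace Ω] (P : Measure Ω) [IsProbabilityMeasure P]
      (X : Fin n → Ω → Fin p → ℝ) (Θs : Matrix (Fin p) (Fin p) ℝ),
    -- the data: i.i.d. sub-Gaussian vectors with covariance matrix `Θs⁻¹`
    iIndepFun X P → (∀ i, HasLaw (X i) ν P) → GLasso.IsSubGaussianLaw σ ν →
    (GLasso.covMat ν).PosDef → Θs = (GLasso.covMat ν)⁻¹ →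
    -- the regularizer
    0 < γ → GLasso.IsAmenableWith μ γ lam ρ →
    cl * Real.sqrt (Real.log p / n) ≤ lam → lam ≤ cu * Real.sqrt (Real.log p / n) →
    -- the population quantities
    GLasso.rowSumNorm (GLasso.covMat ν) ≤ K → GLasso.specNorm Θs ≤ κ₀ →
    GLasso.rowSumNorm (GLasso.invHessianSupp Θs) ≤ cinf →
    -- sample size and minimum signal strength
    c₀ * (GLasso.maxRowNonzero Θs : ℝ) ^ 2 * Real.log p ≤ n →
    (∀ j k, Θs j k ≠ 0 →
      lam * (γ + 2 * cinf) + cβ * Real.sqrt (Real.log p / n) ≤ |Θs j k|) →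
    -- conclusion
    ∃ E : Set Ω, MeasurableSet E ∧ 1 - c₁ * Real.exp (-c₂ * Real.log p) ≤ P.real E ∧
      ∀ ω ∈ E, ∃ Θhat : Matrix (Fin p) (Fin p) ℝ,
        (∀ Θ, GLasso.IsStationary (GLasso.sampleCov fun i => X i ω) ρ (Real.sqrt (2 / μ)) Θ ↔
          Θ = Θhat) ∧
        (∀ Θ, GLasso.IsProgramMinimizer (GLasso.sampleCov fun i => X i ω) ρ
          (Real.sqrt (2 / μ)) Θ ↔ Θ = Θhat) ∧
        (∀ Θ, GLasso.IsOracle (GLasso.sampleCov fun i => X i ω) (GLasso.supp Θs) Θ ↔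
          Θ = Θhat) ∧
        (∀ j k, |Θhat j k - Θs j k| ≤ c₃ * Real.sqrt (Real.log p / n)) ∧
        GLasso.frobNorm (Θhat - Θs) ≤
          c₃ * Real.sqrt (GLasso.numNonzero Θs * Real.log p / n) ∧
        GLasso.specNorm (Θhat - Θs) ≤
          c₃ * min (Real.sqrt (GLasso.numNonzero Θs)) (GLasso.maxRowNonzero Θs) *
            Real.sqrt (Real.log p / n) := by
  obtain ⟨b, hb, Cw, hCw, hevent⟩ := GLasso.exists_sampleCov_event hσ
  set r₀ : ℝ := 2 * cinf * Cw with hr₀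
  have hr₀0 : 0 < r₀ := by positivity
  set a : ℝ := (κ₀ + Real.sqrt (2 / μ)) / 2 with ha
  have ha0 : 0 < a := by have := Real.sqrt_nonneg (2 / μ); linarith
  have haκ : a < Real.sqrt (2 / μ) := by linarith
  have hκa : 0 < a - κ₀ := by linarith
  -- `η` is the smallness required of `d √(log p / n)`, enforced by `c₀ = 1 / η²`. Its four bounds
  -- serve the tail estimate, invertibility, contraction, and the spectral bound `a`.
  obtain ⟨η, hη, hηb, hη1, hη2, hη3⟩ : ∃ η : ℝ, 0 < η ∧ η ≤ b ∧ η ≤ 1 / (2 * K * r₀) ∧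
      η ≤ 1 / (12 * cinf * K ^ 3 * r₀) ∧ η ≤ (a - κ₀) / r₀ :=
    ⟨min (min b (1 / (2 * K * r₀))) (min (1 / (12 * cinf * K ^ 3 * r₀)) ((a - κ₀) / r₀)),
      by positivity, (min_le_left _ _).trans (min_le_left _ _),
      (min_le_left _ _).trans (min_le_right _ _), (min_le_right _ _).trans (min_le_left _ _),
      (min_le_right _ _).trans (min_le_right _ _)⟩
  -- The lower constant for `lam` is exactly what puts the gradient below `lam / 2`. In `cβ`, `r₀`
  -- covers the estimation error and `cu * (4 / μ)` covers the margin `4 lam / μ`.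
  refine ⟨2 * (Cw + 2 * K ^ 2 * r₀), by positivity, 1 / η ^ 2, by positivity, 2, two_pos, 1,
    one_pos, r₀, hr₀0, fun cu hcu => ⟨r₀ + cu * (4 / μ), ?_, ?_⟩⟩
  · have h1 : 0 < 2 * (Cw + 2 * K ^ 2 * r₀) := by positivity
    have h2 : 0 ≤ cu * (4 / μ) := mul_nonneg (h1.le.trans hcu) (by positivity)
    linarith
  intro n p γ lam ρ ν _ Ω _ P _ X Θs hind hlaw hsub hpos hΘs hγ hρ hlam hlam' hK' hκ hc hn hmin
  -- For `p ≤ 1`, `log p = 0` and the required probability is `1 - 2 < 0`, so the empty event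
  -- suffices.
  rcases le_or_gt p 1 with hp | hp
  · have hlog : Real.log p = 0 := by
      interval_cases p <;> simp
    exact ⟨∅, MeasurableSet.empty, by rw [hlog]; norm_num, fun ω hω => hω.elim⟩
  have hlog : 0 < Real.log p := Real.log_pos (by exact_mod_cast hp)
  have hΘ : Θs.PosDef := hΘs ▸ hpos.inv
  have hinv : Θs⁻¹ = GLasso.covMat ν := by
    rw [hΘs, Matrix.nonsing_inv_nonsing_inv _ (GLasso.PosDef.isUnit_det hpos)]
  have hd : (1 : ℝ) ≤ GLasso.maxRowNonzero Θs := by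
    exact_mod_cast GLasso.one_le_maxRowNonzero hΘ (by omega)
  set d : ℝ := ((GLasso.maxRowNonzero Θs : ℕ) : ℝ)
  have hn0 : (0 : ℝ) < n := lt_of_lt_of_le (by positivity) hn
  have hn0' : 0 < n := by exact_mod_cast hn0
  set R := Real.sqrt (Real.log p / n) with hR
  have hR0 : 0 < R := Real.sqrt_pos.2 (by positivity)
  have hdR : d * R ≤ η := by
    refine abs_le_of_sq_le_sq' ?_ hη.le |>.2
    rw [mul_pow, hR, Real.sq_sqrt (by positivity)]
    rw [← mul_div_assoc, div_le_iff₀ hn0]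
    rw [mul_assoc, one_div, inv_mul_le_iff₀ (by positivity)] at hn
    exact hn
  have hRb : R ≤ b := by nlinarith
  obtain ⟨E, hE, hPE, hEw⟩ := hevent n p ν Ω P X hn0' (by omega) hind hlaw hsub hRb
  refine ⟨E, hE, by simpa using hPE, fun ω hω => ?_⟩
  have hlam0 : 0 < lam := lt_of_lt_of_le (by positivity) hlam
  have hdr : d * (r₀ * R) ≤ η * r₀ := by nlinarith
  obtain ⟨T, hT, hT1, hT2, hT3⟩ := GLasso.exists_isCertified (μ := μ) (γ := γ) (lam := lam)
    (κ₀ := κ₀) (a := a) (K := K) (cinf := cinf) (w := Cw * R) (r := r₀ * R) hΘ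
    (GLasso.sampleCov_transpose fun i => X i ω) hK (by rw [hinv]; exact hK') hcinf.le hc
    (by positivity) (by rw [hinv]; exact hEw ω hω) (by rw [hr₀]; ring)
    (by
      rw [le_div_iff₀ (by positivity)] at hη1
      have := mul_le_mul_of_nonneg_left hdr hK.le
      linarith)
    (by
      rw [le_div_iff₀ (by positivity)] at hη2
      have := mul_le_mul_of_nonneg_left hdr (by positivity : 0 ≤ cinf * (6 * K ^ 3))
      linarith)
    hκ
    (by
      rw [le_div_iff₀ hr₀0] at hη3
      linarith)
    (by linarith)
    (fun j k hjk => by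
      have h1 := hmin j k hjk
      have h2 : 4 / μ * lam ≤ 4 / μ * (cu * R) :=
        mul_le_mul_of_nonneg_left hlam' (by positivity)
      have h3 : 0 ≤ lam * (2 * cinf) := by positivity
      linarith)
  refine ⟨T, fun Θ => ⟨fun h => hT.eq_of_isStationary hρ hμ ha0 haκ h, ?_⟩,
    hT.isProgramMinimizer_iff hρ hμ hγ hlam0 ha0 haκ, hT.isOracle_iff ha0, hT1, ?_, ?_⟩
  · rintro rfl
    exact hT.isStationary hρ hμ hlam0 haκ
  · rw [mul_div_assoc, Real.sqrt_mul (by positivity), mul_left_comm]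
    exact hT2
  · refine hT3.trans (le_of_eq ?_)
    ring
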